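/- Theorem 3.2. All locally compact groups are Hausdorff, unitary representations are strongly continuous and act on complex Hilbert spaces. Let $G$ be a non-compact locally compact group with Kazhdan's property (T): there are a compact set $Q\subseteq G$ and $\varepsilon>0$ such that every unitary representation $\pi$ of $G$ that has a vector $\xi\neq 0$ with $\|\pi(s)\xi-\xi\|<\varepsilon\|\xi\|$ for all $s\in Q$ has a nonzero $G$-invariant vector. Suppose that the almost periodic (Bohr) compactification $G^{\mathrm{AP}}$ of $G$, i.e. the closure of the image of $G$ in the product of the unitary groups $U(n)$ over all continuous homomorphisms $G\to U(n)$, $n\in\mathbb N$, is finite. Then the Fourier–Stieltjes algebra $B(G)$ is not operator Connes-amenable. Here $B(G)$ is the algebra, under pointwise operations, of all coefficient functions $\pi_{\xi,\eta}(s)=\langle\pi(s)\xi,\eta\rangle$ of unitary representations $\pi$ of $G$. It is identified with the dual of the full group C*-algebra $C^*(G)$ through $\langle a,\pi_{\xi,\eta}\rangle=\langle\pi(a)\xi,\eta\rangle$, and it carries the resulting weak*-topology and dual operator space structure $M_n(B(G))=CB(C^*(G),M_n)$. A normal dual operator $B(G)$-bimodule is a $B(G)$-bimodule $E=(E_*)^*$,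 with $E_*$ a (complete) operator space and $E$ carrying the dual operator space structure, such that the module actions $B(G)\times E\to E$ and $E\times B(G)\to E$ are (jointly) completely bounded and separately weak*-continuous in each variable. The algebra $B(G)$ is operator Connes-amenable if for every normal dual operator $B(G)$-bimodule $E$ and every weak*-continuous, completely bounded derivation $D\colon B(G)\to E$ there is $x\in E$ with $D(u)=u\cdot x-x\cdot u$ for all $u\in B(G)$. -/

import Mathlib

open MeasureTheory
open scoped ENNReal NNReal TensorProduct CompactlySupported Matrix.Norms.L2Operator

noncomputable section

universe u

/-! ### Operator spaces -/

/-- A choice of a size `‖x‖ ∈ [0, ∞]` for every square matrix `x` over `V`. -/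
class MatrixNorms (V : Type*) where
  matNorm : ∀ {ι : Type} [Fintype ι] [DecidableEq ι], Matrix ι ι V → ℝ≥0∞


/-- The product `α x β` of a matrix `x` over a complex vector space with scalar matrices. -/
def scalarMulMul {V : Type*} [AddCommGroup V] [Module ℂ V] {ι κ : Type} [Fintype κ]
    (α : Matrix ι κ ℂ) (x : Matrix κ κ V) (β : Matrix κ ι ℂ) : Matrix ι ι V :=
  Matrix.of fun i j => ∑ k, ∑ l, (α i k * β l j) • x k l

/-- An (abstract) operator space: a normed space with norms on all the spaces of square
matrices over it, subject to Ruan's axioms. Scalar matrices carry the operator norm between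
Euclidean spaces. (Homogeneity, definiteness and finiteness of the matrix norms, and their
invariance under relabelling of the index set, follow from these axioms.) -/
class OperatorSpace (V : Type*) [NormedAddCommGroup V] [NormedSpace ℂ V]
    extends MatrixNorms V where
  matNorm_single : ∀ v : V, matNorm (Matrix.of fun _ _ : Fin 1 => v) = ‖v‖ₑ
  matNorm_add_le : ∀ {ι : Type} [Fintype ι] [DecidableEq ι] (x y : Matrix ι ι V),
    matNorm (x + y) ≤ matNorm x + matNorm y
  matNorm_scalarMulMul_le : ∀ {ι κ : Type} [Fintype ι] [DecidableEq ι] [Fintype κ] [DecidableEq κ]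
    (α : Matrix ι κ ℂ) (x : Matrix κ κ V) (β : Matrix κ ι ℂ),
    matNorm (scalarMulMul α x β) ≤ ‖α‖ₑ * matNorm x * ‖β‖ₑ
  matNorm_fromBlocks : ∀ {ι κ : Type} [Fintype ι] [DecidableEq ι] [Fintype κ] [DecidableEq κ]
    (x : Matrix ι ι V) (y : Matrix κ κ V),
    matNorm (Matrix.fromBlocks x 0 0 y) = max (matNorm x) (matNorm y)

/-- The dual operator space structure `M_ι(F^*) = CB(F, M_ι)`: the norm of `[u i j]` is the
supremum of the operator norms of the scalar matrices `[u i j (a k l)]`, indexed by pairs, over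
all `m` and all `a ∈ M_m(F)` of norm at most `1`. -/
instance StrongDual.instMatrixNorms (F : Type*) [NormedAddCommGroup F] [NormedSpace ℂ F]
    [MatrixNorms F] : MatrixNorms (StrongDual ℂ F) where
  matNorm {ι} _ _ u := ⨆ (m : ℕ) (a : Matrix (Fin m) (Fin m) F) (_ : MatrixNorms.matNorm a ≤ 1),
    ‖(Matrix.of fun p q : ι × Fin m => u p.1 q.1 (a p.2 q.2))‖ₑ

/-- Complete boundedness of a linear map. -/
def IsCompletelyBounded {V W : Type*} [AddCommGroup V] [Module ℂ V] [AddCommGroup W] [Module ℂ W]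
    [MatrixNorms V] [MatrixNorms W] (T : V →ₗ[ℂ] W) : Prop :=
  ∃ C : ℝ≥0, ∀ (n : ℕ) (x : Matrix (Fin n) (Fin n) V),
    MatrixNorms.matNorm (x.map T) ≤ C * MatrixNorms.matNorm x

/-- (Joint) complete boundedness of a bilinear map, i.e. complete boundedness of the induced map
on the operator space projective tensor product. -/
def IsJointlyCompletelyBounded {U V W : Type*} [AddCommGroup U] [Module ℂ U] [AddCommGroup V]
    [Module ℂ V] [AddCommGroup W] [Module ℂ W] [MatrixNorms U] [MatrixNorms V] [MatrixNorms W]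
    (T : U →ₗ[ℂ] V →ₗ[ℂ] W) : Prop :=
  ∃ C : ℝ≥0, ∀ (n m : ℕ) (x : Matrix (Fin n) (Fin n) U) (y : Matrix (Fin m) (Fin m) V),
    MatrixNorms.matNorm (Matrix.of fun p q : Fin n × Fin m => T (x p.1 q.1) (y p.2 q.2)) ≤
      C * MatrixNorms.matNorm x * MatrixNorms.matNorm y

/-! ### Operator Connes-amenability -/

/-- A normal dual operator `A`-bimodule structure on the dual operator space `E = F^*`, where the
topology of `A` is its weak* topology: `left a x = a · x` and `right a x = x · a`. The actions are
completely bounded; `E` is a dual bimodule, i.e. `x ↦ a · x` and `x ↦ x · a` are weak*-continuous;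
and `E` is normal, i.e. `a ↦ a · x` and `a ↦ x · a` are weak*-continuous. -/
structure NormalDualOperatorBimodule (A : Type*) [Ring A] [Algebra ℂ A] [MatrixNorms A]
    [TopologicalSpace A] (F : Type*) [NormedAddCommGroup F] [NormedSpace ℂ F]
    [OperatorSpace F] where
  left : A →ₗ[ℂ] StrongDual ℂ F →ₗ[ℂ] StrongDual ℂ F
  right : A →ₗ[ℂ] StrongDual ℂ F →ₗ[ℂ] StrongDual ℂ F
  left_mul : ∀ a b x, left (a * b) x = left a (left b x)
  right_mul : ∀ a b x, right (a * b) x = right b (right a x)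
  left_right : ∀ a b x, left a (right b x) = right b (left a x)
  left_cb : IsJointlyCompletelyBounded left
  right_cb : IsJointlyCompletelyBounded right
  left_dual : ∀ a, Continuous fun x : WeakDual ℂ F =>
    StrongDual.toWeakDual (left a (WeakDual.toStrongDual x))
  right_dual : ∀ a, Continuous fun x : WeakDual ℂ F =>
    StrongDual.toWeakDual (right a (WeakDual.toStrongDual x))
  left_normal : ∀ x, Continuous fun a : A => StrongDual.toWeakDual (left a x)
  right_normal : ∀ x, Continuous fun a : A => StrongDual.toWeakDual (right a x)

/-- Operator Connes-amenability of an algebra `A` with given matrix norms, whose topology is its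
weak* topology: every weak*-continuous completely bounded derivation from `A` into a normal dual
operator `A`-bimodule is inner. -/
def IsOperatorConnesAmenable (A : Type u) [Ring A] [Algebra ℂ A] [MatrixNorms A]
    [TopologicalSpace A] : Prop :=
  ∀ (F : Type u) [NormedAddCommGroup F] [NormedSpace ℂ F] [CompleteSpace F] [OperatorSpace F]
    (E : NormalDualOperatorBimodule A F) (D : A →ₗ[ℂ] StrongDual ℂ F),
    IsCompletelyBounded D →
    (Continuous fun a : A => StrongDual.toWeakDual (D a)) →
    (∀ a b, D (a * b) = E.left a (D b) + E.right b (D a)) →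
    ∃ x : StrongDual ℂ F, ∀ a, D a = E.left a x - E.right a x

/-! ### Unitary representations -/

/-- A strongly continuous unitary representation of `G` on a Hilbert space. -/
structure UnitaryRep (G : Type u) [Group G] [TopologicalSpace G] where
  H : Type u
  [normed : NormedAddCommGroup H]
  [innerProduct : InnerProductSpace ℂ H]
  [complete : CompleteSpace H]
  π : G →* (H ≃ₗᵢ[ℂ] H)
  continuous_apply : ∀ ξ : H, Continuous fun s => π s ξ

namespace UnitaryRep

attribute [instance] normed innerProduct complete

section

variable {G : Type u} [Group G] [TopologicalSpace G]

/-- The matrix coefficient `s ↦ ⟨π(s)ξ, η⟩` (Mathlib's inner product is linear in the second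
variable). -/
def coeff (ρ : UnitaryRep G) (ξ η : ρ.H) : G → ℂ := fun s => inner ℂ η (ρ.π s ξ)

/-- A constructor from a multiplicative family of isometries. -/
def ofIsometry (H : Type u) [NormedAddCommGroup H] [InnerProductSpace ℂ H] [CompleteSpace H]
    (T : G → H →L[ℂ] H) (hn : ∀ s ξ, ‖T s ξ‖ = ‖ξ‖) (h1 : ∀ ξ, T 1 ξ = ξ)
    (hm : ∀ s t ξ, T (s * t) ξ = T s (T t ξ)) (hc : ∀ ξ, Continuous fun s => T s ξ) :
    UnitaryRep G where
  H := H
  π :=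
    { toFun := fun s =>
        { toFun := T s
          invFun := T s⁻¹
          left_inv := fun ξ => by rw [← hm]; simp [h1]
          right_inv := fun ξ => by rw [← hm]; simp [h1]
          map_add' := by simp
          map_smul' := by simp
          norm_map' := hn s }
      map_one' := by ext ξ; exact h1 ξ
      map_mul' := fun s t => by ext ξ; exact hm s t ξ }
  continuous_apply := hc

/-- The trivial one-dimensional representation. -/
def trivial (G : Type u) [Group G] [TopologicalSpace G] : UnitaryRep G :=
  ofIsometry (EuclideanSpace ℂ PUnit.{u + 1}) (fun _ => ContinuousLinearMap.id _ _)
    (by simp) (by simp) (by simp) (fun _ => continuous_const)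

/-- The direct sum of two representations. -/
def directSum (ρ σ : UnitaryRep G) : UnitaryRep G :=
  ofIsometry (WithLp 2 (ρ.H × σ.H))
    (fun s => ((WithLp.prodContinuousLinearEquiv 2 ℂ ρ.H σ.H).symm.toContinuousLinearMap).comp
      (((ρ.π s).toContinuousLinearEquiv.toContinuousLinearMap.prodMap
        (σ.π s).toContinuousLinearEquiv.toContinuousLinearMap).comp
        (WithLp.prodContinuousLinearEquiv 2 ℂ ρ.H σ.H).toContinuousLinearMap))
    (by
      intro s ξ
      rw [← sq_eq_sq₀ (norm_nonneg _) (norm_nonneg _), WithLp.prod_norm_sq_eq_of_L2,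
        WithLp.prod_norm_sq_eq_of_L2]
      simp)
    (by intro ξ; simp)
    (by intro s t ξ; simp; rfl)
    (by
      intro ξ
      refine (WithLp.prodContinuousLinearEquiv 2 ℂ ρ.H σ.H).symm.continuous.comp ?_
      exact (ρ.continuous_apply ξ.fst).prodMk (σ.continuous_apply ξ.snd))

/-- The tensor product of two representations, on the Hilbert space tensor product. -/
def tensor (ρ σ : UnitaryRep G) : UnitaryRep G :=
  ofIsometry (UniformSpace.Completion (ρ.H ⊗[ℂ] σ.H))
    (fun s => (TensorProduct.mapIsometry (ρ.π s).toLinearIsometry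
      (σ.π s).toLinearIsometry).toContinuousLinearMap.completion)
    (by
      intro s ξ
      induction ξ using UniformSpace.Completion.induction_on with
      | hp => exact isClosed_eq (by fun_prop) (by fun_prop)
      | ih x => simp)
    (by
      intro ξ
      induction ξ using UniformSpace.Completion.induction_on with
      | hp => exact isClosed_eq (by fun_prop) (by fun_prop)
      | ih x =>
        rw [ContinuousLinearMap.completion_apply_coe]
        congr 1
        induction x using TensorProduct.induction_on with
        | zero => simp
        | tmul x y => simp
        | add x y hx hy => rw [map_add, hx, hy])
    (by
      intro s t ξ
      induction ξ using UniformSpace.Completion.induction_on with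
      | hp => exact isClosed_eq (by fun_prop) (by fun_prop)
      | ih x =>
        simp only [ContinuousLinearMap.completion_apply_coe]
        congr 1
        induction x using TensorProduct.induction_on with
        | zero => simp
        | tmul x y => simp
        | add x y hx hy => simp only [map_add, hx, hy])
    (by
      intro ξ
      refine continuous_of_uniform_approx_of_continuous fun U hU => ?_
      obtain ⟨ε, hε, hεU⟩ := Metric.mem_uniformity_dist.1 hU
      obtain ⟨x, hx⟩ := UniformSpace.Completion.denseRange_coe.exists_dist_lt ξ hε
      refine ⟨fun s => (TensorProduct.mapIsometry (ρ.π s).toLinearIsometry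
        (σ.π s).toLinearIsometry).toContinuousLinearMap.completion x, ?_, fun s => hεU ?_⟩
      · simp only [ContinuousLinearMap.completion_apply_coe]
        refine (UniformSpace.Completion.continuous_coe _).comp ?_
        clear hx
        induction x using TensorProduct.induction_on with
        | zero => simpa using continuous_const
        | tmul x y =>
          exact TensorProduct.continuous_tmul.comp
            ((ρ.continuous_apply x).prodMk (σ.continuous_apply y))
        | add x y hx hy =>
          simp only [map_add]
          exact hx.add hy
      · rw [dist_eq_norm, ← map_sub]
        rw [dist_eq_norm] at hx
        refine lt_of_eq_of_lt ?_ hx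
        generalize ξ - (x : UniformSpace.Completion (ρ.H ⊗[ℂ] σ.H)) = ζ
        induction ζ using UniformSpace.Completion.induction_on with
        | hp => exact isClosed_eq (by fun_prop) (by fun_prop)
        | ih x => simp)

/-- The constant function `1`, sums and products of coefficients. -/
theorem coeff_trivial (c : ℂ) (s : G) :
    (trivial G).coeff (WithLp.toLp 2 fun _ => c : EuclideanSpace ℂ PUnit.{u + 1})
      (WithLp.toLp 2 fun _ => (1 : ℂ) : EuclideanSpace ℂ PUnit.{u + 1}) s = c := by
  change inner ℂ (WithLp.toLp 2 fun _ => (1 : ℂ) : EuclideanSpace ℂ PUnit.{u + 1})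
    (WithLp.toLp 2 fun _ => c : EuclideanSpace ℂ PUnit.{u + 1}) = c
  simp [PiLp.inner_apply]

theorem coeff_directSum (ρ σ : UnitaryRep G) (ξ η : ρ.H) (ξ' η' : σ.H) (s : G) :
    (ρ.directSum σ).coeff (WithLp.toLp 2 (ξ, ξ') : WithLp 2 (ρ.H × σ.H))
      (WithLp.toLp 2 (η, η') : WithLp 2 (ρ.H × σ.H)) s = ρ.coeff ξ η s + σ.coeff ξ' η' s :=
  rfl

theorem coeff_tensor (ρ σ : UnitaryRep G) (ξ η : ρ.H) (ξ' η' : σ.H) (s : G) :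
    (ρ.tensor σ).coeff ((ξ ⊗ₜ[ℂ] ξ' : ρ.H ⊗[ℂ] σ.H) : UniformSpace.Completion (ρ.H ⊗[ℂ] σ.H))
      ((η ⊗ₜ[ℂ] η' : ρ.H ⊗[ℂ] σ.H) : UniformSpace.Completion (ρ.H ⊗[ℂ] σ.H)) s =
      ρ.coeff ξ η s * σ.coeff ξ' η' s := by
  have h : (ρ.tensor σ).π s
      ((ξ ⊗ₜ[ℂ] ξ' : ρ.H ⊗[ℂ] σ.H) : UniformSpace.Completion (ρ.H ⊗[ℂ] σ.H)) =
      ((ρ.π s ξ ⊗ₜ[ℂ] σ.π s ξ' : ρ.H ⊗[ℂ] σ.H) : UniformSpace.Completion (ρ.H ⊗[ℂ] σ.H)) := by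
    exact (ContinuousLinearMap.completion_apply_coe _ _).trans (by simp)
  unfold coeff
  rw [h]
  exact (UniformSpace.Completion.inner_coe _ _).trans (TensorProduct.inner_tmul ..)

end

/-! ### The integrated form of a representation -/

section

variable {G : Type u} [Group G] [TopologicalSpace G] [IsTopologicalGroup G]
  [LocallyCompactSpace G] [MeasurableSpace G] [BorelSpace G]

theorem integrable_smul (ρ : UnitaryRep G) (f : C_c(G, ℂ)) (ξ : ρ.H) :
    Integrable (fun s => f s • ρ.π s ξ) (Measure.haar : Measure G) :=
  (f.continuous.smul (ρ.continuous_apply ξ)).integrable_of_hasCompactSupport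
    f.hasCompactSupport.smul_right

/-- The operator `π(f) = ∫ f(s) π(s) ds` (in the strong sense), with respect to left Haar
measure. -/
def integrate (ρ : UnitaryRep G) : C_c(G, ℂ) →ₗ[ℂ] (ρ.H →L[ℂ] ρ.H) where
  toFun f := LinearMap.mkContinuous
    { toFun := fun ξ => ∫ s, f s • ρ.π s ξ ∂(Measure.haar : Measure G)
      map_add' := fun ξ η => by
        simp only [map_add, smul_add]
        exact integral_add (ρ.integrable_smul f ξ) (ρ.integrable_smul f η)
      map_smul' := fun c ξ => by
        simp only [map_smul, RingHom.id_apply]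
        rw [← integral_smul]
        simp only [smul_comm c] }
    (∫ s, ‖f s‖ ∂(Measure.haar : Measure G))
    (fun ξ => by
      refine (norm_integral_le_integral_norm _).trans (le_of_eq ?_)
      simp only [norm_smul, LinearIsometryEquiv.norm_map]
      exact integral_mul_const _ _)
  map_add' f g := by
    ext ξ
    simp only [CompactlySupportedContinuousMap.coe_add, Pi.add_apply, add_smul]
    exact integral_add (ρ.integrable_smul f ξ) (ρ.integrable_smul g ξ)
  map_smul' c f := by
    ext ξ
    simp only [CompactlySupportedContinuousMap.coe_smul, Pi.smul_apply, smul_assoc]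
    exact integral_smul _ _

theorem integrate_apply (ρ : UnitaryRep G) (f : C_c(G, ℂ)) (ξ : ρ.H) :
    ρ.integrate f ξ = ∫ s, f s • ρ.π s ξ ∂(Measure.haar : Measure G) := rfl

theorem norm_integrate_le (ρ : UnitaryRep G) (f : C_c(G, ℂ)) :
    ‖ρ.integrate f‖ ≤ ∫ s, ‖f s‖ ∂(Measure.haar : Measure G) :=
  LinearMap.mkContinuous_norm_le _ (integral_nonneg fun _ => norm_nonneg _) (fun ξ => by
    refine (norm_integral_le_integral_norm _).trans (le_of_eq ?_)
    simp only [norm_smul, LinearIsometryEquiv.norm_map]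
    exact integral_mul_const _ _)

theorem inner_integrate (ρ : UnitaryRep G) (f : C_c(G, ℂ)) (ξ η : ρ.H) :
    inner ℂ η (ρ.integrate f ξ) = ∫ s, f s * ρ.coeff ξ η s ∂(Measure.haar : Measure G) := by
  rw [integrate_apply, ← integral_inner (ρ.integrable_smul f ξ)]
  simp only [inner_smul_right, coeff]

end

end UnitaryRep

/-! ### The full group C*-algebra as an operator space -/

section

variable (G : Type u) [Group G] [TopologicalSpace G] [IsTopologicalGroup G]
  [LocallyCompactSpace G] [MeasurableSpace G] [BorelSpace G]

/-- The space `C_c(G)`, to be given the universal C*-seminorm. -/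
def PreGroupCStar : Type u := C_c(G, ℂ)

instance : AddCommGroup (PreGroupCStar G) := inferInstanceAs (AddCommGroup C_c(G, ℂ))

instance : Module ℂ (PreGroupCStar G) := inferInstanceAs (Module ℂ C_c(G, ℂ))

/-- The underlying function of an element of `PreGroupCStar G`. -/
def PreGroupCStar.toCc : PreGroupCStar G ≃ₗ[ℂ] C_c(G, ℂ) := LinearEquiv.refl ℂ C_c(G, ℂ)

/-- The universal C*-seminorm `‖f‖ = sup_π ‖π(f)‖`, over all unitary representations of `G`. -/
instance : Norm (PreGroupCStar G) where
  norm f := ⨆ ρ : UnitaryRep G, ‖ρ.integrate (PreGroupCStar.toCc G f)‖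

variable {G}

theorem UnitaryRep.norm_integrate_le_norm (ρ : UnitaryRep G) (f : PreGroupCStar G) :
    ‖ρ.integrate (PreGroupCStar.toCc G f)‖ ≤ ‖f‖ :=
  le_ciSup (f := fun ρ : UnitaryRep G => ‖ρ.integrate (PreGroupCStar.toCc G f)‖)
    ⟨_, by rintro _ ⟨σ, rfl⟩; exact σ.norm_integrate_le _⟩ ρ

theorem PreGroupCStar.norm_le {f : PreGroupCStar G} {C : ℝ}
    (h : ∀ ρ : UnitaryRep G, ‖ρ.integrate (PreGroupCStar.toCc G f)‖ ≤ C) : ‖f‖ ≤ C :=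
  haveI : Nonempty (UnitaryRep G) := ⟨UnitaryRep.trivial G⟩
  ciSup_le h

theorem PreGroupCStar.core : SeminormedSpace.Core ℂ (PreGroupCStar G) where
  norm_nonneg f := (norm_nonneg _).trans ((UnitaryRep.trivial G).norm_integrate_le_norm f)
  norm_smul c f := by
    change ⨆ ρ : UnitaryRep G, ‖ρ.integrate (PreGroupCStar.toCc G (c • f))‖ =
      ‖c‖ * ⨆ ρ : UnitaryRep G, ‖ρ.integrate (PreGroupCStar.toCc G f)‖
    simp only [map_smul, norm_smul]
    exact (Real.mul_iSup_of_nonneg (norm_nonneg c) _).symm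
  norm_triangle f g := PreGroupCStar.norm_le fun ρ => by
    rw [map_add, map_add]
    exact (norm_add_le _ _).trans
      (add_le_add (ρ.norm_integrate_le_norm f) (ρ.norm_integrate_le_norm g))

variable (G)

instance : SeminormedAddCommGroup (PreGroupCStar G) :=
  SeminormedAddCommGroup.ofCore PreGroupCStar.core

instance : NormedSpace ℂ (PreGroupCStar G) where
  norm_smul_le c f := (PreGroupCStar.core.norm_smul c f).le

/-- The full group C*-algebra `C*(G)`, as a Banach space: the completion of `C_c(G)` (equivalently,
of `L¹(G)`) in the norm `sup_π ‖π(f)‖`. -/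
abbrev GroupCStar : Type u := UniformSpace.Completion (PreGroupCStar G)

variable {G}

/-- The extension of a unitary representation `π` of `G` to `C*(G)`. -/
def UnitaryRep.extend (ρ : UnitaryRep G) : GroupCStar G →L[ℂ] (ρ.H →L[ℂ] ρ.H) :=
  (LinearMap.mkContinuous (ρ.integrate ∘ₗ (PreGroupCStar.toCc G).toLinearMap) 1
    (fun f => by rw [one_mul]; exact ρ.norm_integrate_le_norm f)).extend
    (UniformSpace.Completion.toComplL : PreGroupCStar G →L[ℂ] GroupCStar G)

theorem UnitaryRep.extend_coe (ρ : UnitaryRep G) (f : PreGroupCStar G) :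
    ρ.extend (f : GroupCStar G) = ρ.integrate (PreGroupCStar.toCc G f) :=
  ContinuousLinearMap.extend_eq _ UniformSpace.Completion.denseRange_coe
    (UniformSpace.Completion.isUniformInducing_coe _) f

/-- The bounded operator on `H^ι` given by a matrix of bounded operators on `H`. -/
def opMatrix {H : Type*} [NormedAddCommGroup H] [InnerProductSpace ℂ H] {ι : Type} [Fintype ι]
    (X : Matrix ι ι (H →L[ℂ] H)) :
    PiLp 2 (fun _ : ι => H) →L[ℂ] PiLp 2 (fun _ : ι => H) :=
  (PiLp.continuousLinearEquiv 2 ℂ (fun _ : ι => H)).symm.toContinuousLinearMap.comp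
    ((ContinuousLinearMap.pi fun i => ∑ j, (X i j).comp (ContinuousLinearMap.proj j)).comp
      (PiLp.continuousLinearEquiv 2 ℂ (fun _ : ι => H)).toContinuousLinearMap)

/-- The matrix norms of the C*-algebra `C*(G)`: `‖[a i j]‖ = sup_π ‖[π(a i j)]‖`. -/
instance : MatrixNorms (GroupCStar G) where
  matNorm a := ⨆ ρ : UnitaryRep G, ‖opMatrix (a.map ρ.extend)‖ₑ

/-! ### The Fourier-Stieltjes algebra -/

section

variable (G : Type u) [Group G] [TopologicalSpace G]

/-- The Fourier-Stieltjes algebra as an algebra of functions on `G`, with the pointwise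
operations: the set of all matrix coefficients of unitary representations of `G`. -/
def fourierStieltjesSubalgebra : Subalgebra ℂ (G → ℂ) where
  carrier := {u | ∃ (ρ : UnitaryRep G) (ξ η : ρ.H), u = ρ.coeff ξ η}
  add_mem' := by
    rintro _ _ ⟨ρ, ξ, η, rfl⟩ ⟨σ, ξ', η', rfl⟩
    exact ⟨ρ.directSum σ, _, _, funext fun s => (ρ.coeff_directSum σ ξ η ξ' η' s).symm⟩
  mul_mem' := by
    rintro _ _ ⟨ρ, ξ, η, rfl⟩ ⟨σ, ξ', η', rfl⟩
    exact ⟨ρ.tensor σ, _, _, funext fun s => (ρ.coeff_tensor σ ξ η ξ' η' s).symm⟩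
  algebraMap_mem' c :=
    ⟨UnitaryRep.trivial G, _, _, funext fun s => (UnitaryRep.coeff_trivial c s).symm⟩

/-- The Fourier-Stieltjes algebra `B(G)`. -/
def FourierStieltjes : Type u := fourierStieltjesSubalgebra G

instance : CommRing (FourierStieltjes G) :=
  inferInstanceAs (CommRing (fourierStieltjesSubalgebra G))

instance : Algebra ℂ (FourierStieltjes G) :=
  inferInstanceAs (Algebra ℂ (fourierStieltjesSubalgebra G))

variable {G}

/-- The elements of `B(G)` as functions on `G`. -/
def FourierStieltjes.toFun : FourierStieltjes G →ₐ[ℂ] (G → ℂ) :=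
  (fourierStieltjesSubalgebra G).val

theorem FourierStieltjes.exists_coeff (u : FourierStieltjes G) :
    ∃ (ρ : UnitaryRep G) (ξ η : ρ.H), toFun u = ρ.coeff ξ η := u.2

end

namespace FourierStieltjes

/-- The linear functional `f ↦ ∫ f u` on `C_c(G)`, for `u ∈ B(G)`. -/
def preFunctional (u : FourierStieltjes G) : PreGroupCStar G →ₗ[ℂ] ℂ where
  toFun f := ∫ s, PreGroupCStar.toCc G f s * toFun u s ∂(Measure.haar : Measure G)
  map_add' f g := by
    obtain ⟨ρ, ξ, η, h⟩ := exists_coeff u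
    simp only [h, ← ρ.inner_integrate]
    simp
  map_smul' c f := by
    obtain ⟨ρ, ξ, η, h⟩ := exists_coeff u
    simp only [h, ← ρ.inner_integrate]
    simp

/-- The functional `f ↦ ∫ f u` is bounded for the norm of `C*(G)`. -/
theorem exists_bound_preFunctional (u : FourierStieltjes G) :
    ∃ C, ∀ f : PreGroupCStar G, ‖preFunctional u f‖ ≤
      C * ‖(UniformSpace.Completion.toComplL : PreGroupCStar G →L[ℂ] GroupCStar G) f‖ := by
  obtain ⟨ρ, ξ, η, h⟩ := exists_coeff u
  refine ⟨‖ξ‖ * ‖η‖, fun f => ?_⟩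
  have h1 : preFunctional u f = inner ℂ η (ρ.integrate (PreGroupCStar.toCc G f) ξ) := by
    rw [ρ.inner_integrate, ← h]; rfl
  rw [h1, UniformSpace.Completion.coe_toComplL, UniformSpace.Completion.norm_coe]
  calc ‖inner ℂ η (ρ.integrate (PreGroupCStar.toCc G f) ξ)‖
      ≤ ‖η‖ * ‖ρ.integrate (PreGroupCStar.toCc G f) ξ‖ := norm_inner_le_norm _ _
    _ ≤ ‖η‖ * (‖f‖ * ‖ξ‖) := by
        gcongr
        exact ContinuousLinearMap.le_of_opNorm_le _ (ρ.norm_integrate_le_norm f) ξ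
    _ = ‖ξ‖ * ‖η‖ * ‖f‖ := by ring

/-- The functional on `C*(G)` given by `u ∈ B(G)`: the continuous extension of `f ↦ ∫ f u`. -/
def functional (u : FourierStieltjes G) : StrongDual ℂ (GroupCStar G) :=
  (preFunctional u).extendOfNorm
    (UniformSpace.Completion.toComplL : PreGroupCStar G →L[ℂ] GroupCStar G).toLinearMap

theorem functional_coe (u : FourierStieltjes G) (f : PreGroupCStar G) :
    functional u (f : GroupCStar G) =
      ∫ s, PreGroupCStar.toCc G f s * toFun u s ∂(Measure.haar : Measure G) :=
  LinearMap.extendOfNorm_eq (f := preFunctional u)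
    (e := (UniformSpace.Completion.toComplL : PreGroupCStar G →L[ℂ] GroupCStar G).toLinearMap)
    UniformSpace.Completion.denseRange_coe (exists_bound_preFunctional u) f

/-- The pairing of `C*(G)` with `B(G)` is given by `⟨a, π_{ξ,η}⟩ = ⟨π(a)ξ, η⟩`. -/
theorem functional_eq_inner (u : FourierStieltjes G) (ρ : UnitaryRep G) (ξ η : ρ.H)
    (h : toFun u = ρ.coeff ξ η) (a : GroupCStar G) :
    functional u a = inner ℂ η (ρ.extend a ξ) := by
  induction a using UniformSpace.Completion.induction_on with
  | hp => exact isClosed_eq (by fun_prop) (by fun_prop)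
  | ih f => rw [functional_coe, h, ρ.extend_coe, ρ.inner_integrate]

theorem integrable_mul (u : FourierStieltjes G) (f : C_c(G, ℂ)) :
    Integrable (fun s => f s * toFun u s) (Measure.haar : Measure G) := by
  obtain ⟨ρ, ξ, η, h⟩ := exists_coeff u
  have := (ρ.integrable_smul f ξ).const_inner (𝕜 := ℂ) η
  simpa only [inner_smul_right, h, UnitaryRep.coeff] using this

/-- The identification of `B(G)` with the dual of `C*(G)`. -/
def toDual : FourierStieltjes G →ₗ[ℂ] StrongDual ℂ (GroupCStar G) where
  toFun := functional
  map_add' u v := by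
    ext a
    induction a using UniformSpace.Completion.induction_on with
    | hp => exact isClosed_eq (by fun_prop) (by fun_prop)
    | ih f =>
      rw [add_apply]
      simp only [functional_coe, map_add, Pi.add_apply, mul_add]
      exact integral_add (integrable_mul u _) (integrable_mul v _)
  map_smul' c u := by
    ext a
    induction a using UniformSpace.Completion.induction_on with
    | hp => exact isClosed_eq (by fun_prop) (by fun_prop)
    | ih f =>
      rw [smul_apply]
      simp only [functional_coe, map_smul, Pi.smul_apply, mul_smul_comm, RingHom.id_apply]
      exact integral_smul _ _

/-- The dual operator space structure of `B(G) = C*(G)^*`. -/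
instance : MatrixNorms (FourierStieltjes G) where
  matNorm u := MatrixNorms.matNorm (u.map toDual)

/-- The weak* topology of `B(G) = C*(G)^*`. -/
instance : TopologicalSpace (FourierStieltjes G) :=
  TopologicalSpace.induced (fun u => StrongDual.toWeakDual (toDual u)) inferInstance

end FourierStieltjes

end

/-! ### Property (T) and the almost periodic compactification -/

/-- Kazhdan's property (T): there are a compact set `Q` and `ε > 0` such that every unitary
representation with a nonzero `(Q, ε)`-invariant vector has a nonzero invariant vector. -/
def HasPropertyT (G : Type u) [Group G] [TopologicalSpace G] : Prop :=
  ∃ Q : Set G, IsCompact Q ∧ ∃ ε : ℝ, 0 < ε ∧ ∀ ρ : UnitaryRep G,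
    (∃ ξ : ρ.H, ξ ≠ 0 ∧ ∀ s ∈ Q, ‖ρ.π s ξ - ξ‖ < ε * ‖ξ‖) →
    ∃ ξ : ρ.H, ξ ≠ 0 ∧ ∀ s, ρ.π s ξ = ξ

section

variable (G : Type u) [Group G] [TopologicalSpace G]

/-- The homomorphism from `G` into the product of the unitary groups `U(n)` over all continuous
finite-dimensional unitary representations `G → U(n)`. -/
def toUnitaryProduct : G →* ((p : Σ n : ℕ, G →ₜ* Matrix.unitaryGroup (Fin n) ℂ) →
    Matrix.unitaryGroup (Fin p.1) ℂ) :=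
  MonoidHom.pi fun p => p.2.toMonoidHom

/-- The almost periodic (Bohr) compactification of `G`: the closure of the image of `G` in the
product of the unitary groups over all its continuous finite-dimensional unitary
representations. -/
abbrev AlmostPeriodicCompactification : Type u :=
  (toUnitaryProduct G).range.topologicalClosure

end

end

/-!
`B(G)` acts on its predual `C*(G)`. Property (T) provides a Kazhdan projection `q` in `C*(G)`, which
acts in every representation as the projection onto the invariant vectors. As `G` has a finite Bohr
compactification, the joint kernel `N` of the finite-dimensional unitary representations is an open
subgroup of finite index, so that `b = [G : N] 1_N` belongs to `B(G)`. An invariant vector of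
`ρ ⊗ σ` has compact slice maps, hence lies over the finite-dimensional invariant subspaces of `ρ`,
on which `N` acts trivially. This makes `p = b · q` a character of `B(G)`, which is weak*-continuous
but vanishes at infinity: it annihilates the coefficients of the regular representation, as `G` is
not compact.

Such a character is incompatible with operator Connes-amenability. Let `E` be the dual of the
augmentation ideal of `C*(G)`, identified with the quotient of `C*(G)` by the line through `p`. Let
`B(G)` act on `E` from the left by the transpose of its action on `C*(G)`, and from the right by
the character `p`. Restriction of functionals is then a derivation from `B(G)` into `E`. A
functional implementing it, extended to `C*(G)` by `0` on `p`, agrees with the trivial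
representation on `C_c(G)`, where elements of `B(G)` annihilated by `p` act as local units. But the
trivial representation takes the value `1` at `p`.
-/

noncomputable section

universe u

/-! ### Scalar matrices and matrices of operators -/

section

variable {ι κ : Type*} [Fintype ι] [Fintype κ] [DecidableEq κ]

theorem sum_norm_sq_mulVec_le (α : Matrix ι κ ℂ) (x : κ → ℂ) :
    ∑ i, ‖∑ k, α i k * x k‖ ^ 2 ≤ ‖α‖ ^ 2 * ∑ k, ‖x k‖ ^ 2 := by
  have h := pow_le_pow_left₀ (norm_nonneg _) (Matrix.l2_opNorm_mulVec α (WithLp.toLp 2 x)) 2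
  rwa [mul_pow, EuclideanSpace.norm_sq_eq, EuclideanSpace.norm_sq_eq] at h

theorem sum_norm_sq_smul_le {H : Type*} [NormedAddCommGroup H] [InnerProductSpace ℂ H]
    (α : Matrix ι κ ℂ) (x : κ → H) :
    ∑ i, ‖∑ k, α i k • x k‖ ^ 2 ≤ ‖α‖ ^ 2 * ∑ k, ‖x k‖ ^ 2 := by
  let V : Submodule ℂ H := Submodule.span ℂ (Set.range x)
  have : FiniteDimensional ℂ V := FiniteDimensional.span_of_finite ℂ (Set.finite_range x)
  let b := stdOrthonormalBasis ℂ V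
  let y : κ → V := fun k => ⟨x k, Submodule.subset_span ⟨k, rfl⟩⟩
  have parseval (v : V) : ‖(v : H)‖ ^ 2 = ∑ l, ‖inner ℂ (b l) v‖ ^ 2 := by
    rw [b.sum_sq_norm_inner_right]; rfl
  have hrow (i : ι) : ‖∑ k, α i k • x k‖ ^ 2 = ∑ l, ‖∑ k, α i k * inner ℂ (b l) (y k)‖ ^ 2 := by
    have : ∑ k, α i k • x k = ((∑ k, α i k • y k : V) : H) := by simp [y]
    rw [this, parseval]
    simp only [inner_sum, inner_smul_right]
  have hcol (k : κ) : ‖x k‖ ^ 2 = ∑ l, ‖inner ℂ (b l) (y k)‖ ^ 2 := parseval (y k)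
  simp only [hrow, hcol]
  rw [Finset.sum_comm, Finset.sum_comm (s := (Finset.univ : Finset κ)), Finset.mul_sum]
  exact Finset.sum_le_sum fun l _ => sum_norm_sq_mulVec_le α _

theorem l2_opNorm_one_le_one : ‖(1 : Matrix κ κ ℂ)‖ ≤ 1 := by
  rw [← Matrix.diagonal_one, Matrix.l2_opNorm_diagonal]
  exact (pi_norm_le_iff_of_nonneg zero_le_one).2 fun _ => norm_one.le

variable [DecidableEq ι]

theorem l2_opNorm_one_submatrix_id_le_one {e : ι → κ} (he : Function.Injective e) :
    ‖(1 : Matrix κ κ ℂ).submatrix id e‖ ≤ 1 := by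
  have hmul : ((1 : Matrix κ κ ℂ).submatrix id e).conjTranspose *
      (1 : Matrix κ κ ℂ).submatrix id e = 1 := by
    rw [Matrix.conjTranspose_submatrix, Matrix.conjTranspose_one,
      ← Matrix.submatrix_mul _ _ _ _ _ Function.bijective_id, mul_one, Matrix.submatrix_one _ he]
  have h := Matrix.l2_opNorm_conjTranspose_mul_self ((1 : Matrix κ κ ℂ).submatrix id e)
  rw [hmul] at h
  nlinarith [l2_opNorm_one_le_one (κ := ι)]

omit [DecidableEq ι] in
theorem l2_opNorm_one_submatrix_le_one {e : ι → κ} (he : Function.Injective e) :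
    ‖(1 : Matrix κ κ ℂ).submatrix e id‖ ≤ 1 := by
  classical
  rw [← Matrix.l2_opNorm_conjTranspose, Matrix.conjTranspose_submatrix, Matrix.conjTranspose_one]
  exact l2_opNorm_one_submatrix_id_le_one he

theorem l2_opNorm_submatrix_le (α : Matrix κ κ ℂ) {e : ι → κ} (he : Function.Injective e) :
    ‖α.submatrix e e‖ ≤ ‖α‖ := by
  have h : α.submatrix e e =
      (1 : Matrix κ κ ℂ).submatrix e id * (α * (1 : Matrix κ κ ℂ).submatrix id e) := by
    ext i j
    simp [Matrix.mul_apply, Matrix.one_apply]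
  rw [h]
  calc _ ≤ 1 * (‖α‖ * 1) := by
        refine (Matrix.l2_opNorm_mul _ _).trans ?_
        gcongr
        · exact l2_opNorm_one_submatrix_le_one he
        · refine (Matrix.l2_opNorm_mul _ _).trans ?_
          gcongr
          exact l2_opNorm_one_submatrix_id_le_one he
    _ = ‖α‖ := by ring

theorem norm_sum_star_mul_le (W : Matrix κ κ ℂ) (x y : κ → ℂ) :
    ‖∑ p, ∑ q, starRingEnd ℂ (y p) * W p q * x q‖ ≤
      ‖W‖ * √(∑ q, ‖x q‖ ^ 2) * √(∑ p, ‖y p‖ ^ 2) := by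
  have h : ∑ p, ∑ q, starRingEnd ℂ (y p) * W p q * x q =
      inner ℂ (WithLp.toLp 2 y : EuclideanSpace ℂ κ)
        (WithLp.toLp 2 (W.mulVec x) : EuclideanSpace ℂ κ) := by
    simp only [PiLp.inner_apply, RCLike.inner_apply, Matrix.mulVec, dotProduct, Finset.sum_mul]
    exact Finset.sum_congr rfl fun p _ => Finset.sum_congr rfl fun q _ => by ring
  rw [h, mul_comm, ← EuclideanSpace.norm_eq (WithLp.toLp 2 x),
    ← EuclideanSpace.norm_eq (WithLp.toLp 2 y)]
  exact (norm_inner_le_norm _ _).trans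
    (mul_le_mul_of_nonneg_left (W.l2_opNorm_mulVec (WithLp.toLp 2 x)) (norm_nonneg _))

end

theorem submatrix_eq_scalarMulMul {V : Type*} [AddCommGroup V] [Module ℂ V] {ι κ : Type}
    [Fintype κ] [DecidableEq κ] (x : Matrix κ κ V) (e f : ι → κ) :
    x.submatrix e f = scalarMulMul ((1 : Matrix κ κ ℂ).submatrix e id) x
      ((1 : Matrix κ κ ℂ).submatrix id f) := by
  ext i j
  simp [scalarMulMul, Matrix.one_apply, ite_smul]

section

variable {H : Type*} [NormedAddCommGroup H] [InnerProductSpace ℂ H] {ι κ : Type} [Fintype ι]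
  [Fintype κ]

theorem opMatrix_apply (X : Matrix ι ι (H →L[ℂ] H)) (x : PiLp 2 (fun _ : ι => H)) (i : ι) :
    opMatrix X x i = ∑ j, X i j (x j) := by
  simp [opMatrix]

theorem opMatrix_add (X Y : Matrix ι ι (H →L[ℂ] H)) :
    opMatrix (X + Y) = opMatrix X + opMatrix Y := by
  ext x i
  simp [opMatrix_apply, Finset.sum_add_distrib]

theorem inner_opMatrix (X : Matrix ι ι (H →L[ℂ] H)) (x y : PiLp 2 (fun _ : ι => H)) :
    inner ℂ y (opMatrix X x) = ∑ i, ∑ j, inner ℂ (y i) (X i j (x j)) := by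
  simp only [PiLp.inner_apply, opMatrix_apply, inner_sum]

theorem sum_norm_sq_opMatrix_le (X : Matrix ι ι (H →L[ℂ] H)) (x : ι → H) :
    ∑ i, ‖∑ j, X i j (x j)‖ ^ 2 ≤ ‖opMatrix X‖ ^ 2 * ∑ j, ‖x j‖ ^ 2 := by
  have h := pow_le_pow_left₀ (norm_nonneg _) ((opMatrix X).le_opNorm (WithLp.toLp 2 x)) 2
  rw [mul_pow, PiLp.norm_sq_eq_of_L2, PiLp.norm_sq_eq_of_L2] at h
  simpa only [opMatrix_apply] using h

theorem norm_opMatrix_le_of_sum_norm_sq_le (X : Matrix ι ι (H →L[ℂ] H)) {C : ℝ} (hC : 0 ≤ C)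
    (h : ∀ x : ι → H, ∑ i, ‖∑ j, X i j (x j)‖ ^ 2 ≤ C ^ 2 * ∑ j, ‖x j‖ ^ 2) :
    ‖opMatrix X‖ ≤ C := by
  refine ContinuousLinearMap.opNorm_le_bound _ hC fun x => le_of_sq_le_sq ?_ (by positivity)
  rw [mul_pow, PiLp.norm_sq_eq_of_L2, PiLp.norm_sq_eq_of_L2]
  simpa only [opMatrix_apply] using h x

theorem norm_opMatrix_le_of_inner_le (X : Matrix ι ι (H →L[ℂ] H)) {C : ℝ} (hC : 0 ≤ C)
    (h : ∀ x y : PiLp 2 (fun _ : ι => H), ‖x‖ = 1 → ‖y‖ = 1 →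
      ‖∑ i, ∑ j, inner ℂ (y i) (X i j (x j))‖ ≤ C) : ‖opMatrix X‖ ≤ C := by
  refine ContinuousLinearMap.opNorm_le_of_re_inner_le (𝕜 := ℂ) hC fun x y hx hy => ?_
  rw [inner_re_symm, inner_opMatrix]
  exact (Complex.re_le_norm _).trans (h x y hx hy)

theorem norm_opMatrix_single (T : H →L[ℂ] H) :
    ‖opMatrix (Matrix.of fun _ _ : Fin 1 => T)‖ = ‖T‖ := by
  refine le_antisymm (norm_opMatrix_le_of_sum_norm_sq_le _ (norm_nonneg _) fun x => ?_)
    (T.opNorm_le_bound (ContinuousLinearMap.opNorm_nonneg _) fun x =>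
      le_of_sq_le_sq ?_ (by positivity))
  · simpa [← mul_pow] using pow_le_pow_left₀ (norm_nonneg _) (T.le_opNorm (x 0)) 2
  · simpa [← mul_pow] using sum_norm_sq_opMatrix_le (Matrix.of fun _ _ : Fin 1 => T) (fun _ => x)

theorem norm_opMatrix_scalarMulMul_le [DecidableEq ι] [DecidableEq κ] (α : Matrix ι κ ℂ)
    (X : Matrix κ κ (H →L[ℂ] H)) (β : Matrix κ ι ℂ) :
    ‖opMatrix (scalarMulMul α X β)‖ ≤ ‖α‖ * ‖opMatrix X‖ * ‖β‖ := by
  refine norm_opMatrix_le_of_sum_norm_sq_le _ (by positivity) fun x => ?_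
  have hfactor (i : ι) : ∑ j, scalarMulMul α X β i j (x j) =
      ∑ k, α i k • ∑ l, X k l (∑ j, β l j • x j) := by
    simp only [scalarMulMul, Matrix.of_apply, sum_apply, smul_apply,
      map_sum, map_smul, Finset.smul_sum, smul_smul]
    rw [Finset.sum_comm]
    exact Finset.sum_congr rfl fun k _ => Finset.sum_comm
  simp only [hfactor]
  calc _ ≤ ‖α‖ ^ 2 * ∑ k, ‖∑ l, X k l (∑ j, β l j • x j)‖ ^ 2 := sum_norm_sq_smul_le α _
    _ ≤ ‖α‖ ^ 2 * (‖opMatrix X‖ ^ 2 * ∑ l, ‖∑ j, β l j • x j‖ ^ 2) := by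
        gcongr; exact sum_norm_sq_opMatrix_le X _
    _ ≤ ‖α‖ ^ 2 * (‖opMatrix X‖ ^ 2 * (‖β‖ ^ 2 * ∑ j, ‖x j‖ ^ 2)) := by
        gcongr; exact sum_norm_sq_smul_le β _
    _ = _ := by ring

theorem norm_opMatrix_submatrix_le (X : Matrix κ κ (H →L[ℂ] H)) {e : ι → κ}
    (he : Function.Injective e) : ‖opMatrix (X.submatrix e e)‖ ≤ ‖opMatrix X‖ := by
  classical
  rw [submatrix_eq_scalarMulMul]
  calc _ ≤ 1 * ‖opMatrix X‖ * 1 := by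
        refine (norm_opMatrix_scalarMulMul_le _ X _).trans ?_
        gcongr
        exacts [l2_opNorm_one_submatrix_le_one he, l2_opNorm_one_submatrix_id_le_one he]
    _ = _ := by ring

theorem norm_opMatrix_fromBlocks (X : Matrix ι ι (H →L[ℂ] H)) (Y : Matrix κ κ (H →L[ℂ] H)) :
    ‖opMatrix (Matrix.fromBlocks X 0 0 Y)‖ = max ‖opMatrix X‖ ‖opMatrix Y‖ := by
  refine le_antisymm (norm_opMatrix_le_of_sum_norm_sq_le _ (by positivity) fun x => ?_)
    (max_le ?_ ?_)
  · simp only [Fintype.sum_sum_type, Matrix.fromBlocks_apply₁₁, Matrix.fromBlocks_apply₁₂,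
      Matrix.fromBlocks_apply₂₁, Matrix.fromBlocks_apply₂₂, Matrix.zero_apply,
      zero_apply, Finset.sum_const_zero, add_zero, zero_add, mul_add]
    refine add_le_add ((sum_norm_sq_opMatrix_le X _).trans ?_)
      ((sum_norm_sq_opMatrix_le Y _).trans ?_) <;> gcongr
    exacts [le_max_left _ _, le_max_right _ _]
  · exact (congrArg _ (congrArg _ (Matrix.toBlocks_fromBlocks₁₁ X 0 0 Y))).symm.trans_le
      (norm_opMatrix_submatrix_le _ Sum.inl_injective)
  · exact (congrArg _ (congrArg _ (Matrix.toBlocks_fromBlocks₂₂ X 0 0 Y))).symm.trans_le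
      (norm_opMatrix_submatrix_le _ Sum.inr_injective)

theorem norm_opMatrix_kronecker_le [DecidableEq ι] (c : Matrix ι ι ℂ)
    (X : Matrix κ κ (H →L[ℂ] H)) :
    ‖opMatrix (Matrix.of fun p q : ι × κ => c p.1 q.1 • X p.2 q.2)‖ ≤ ‖c‖ * ‖opMatrix X‖ := by
  refine norm_opMatrix_le_of_sum_norm_sq_le _ (by positivity) fun x => ?_
  have hfactor (i : ι) (k : κ) : ∑ q : ι × κ, (c i q.1 • X k q.2) (x q) =
      ∑ j, c i j • ∑ l, X k l (x (j, l)) := by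
    simp [Fintype.sum_prod_type, Finset.smul_sum]
  simp only [Matrix.of_apply]
  rw [Fintype.sum_prod_type, Finset.sum_comm]
  simp only [hfactor]
  calc _ ≤ ∑ k, ‖c‖ ^ 2 * ∑ j, ‖∑ l, X k l (x (j, l))‖ ^ 2 :=
        Finset.sum_le_sum fun k _ => sum_norm_sq_smul_le c _
    _ = ‖c‖ ^ 2 * ∑ j, ∑ k, ‖∑ l, X k l (x (j, l))‖ ^ 2 := by
        rw [← Finset.mul_sum, Finset.sum_comm]
    _ ≤ ‖c‖ ^ 2 * ∑ j, (‖opMatrix X‖ ^ 2 * ∑ l, ‖x (j, l)‖ ^ 2) := by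
        gcongr
        exact sum_norm_sq_opMatrix_le X _
    _ = _ := by rw [← Finset.mul_sum, ← Fintype.sum_prod_type (fun q : ι × κ => ‖x q‖ ^ 2)]; ring

end

/-! ### Operator spaces -/

namespace OperatorSpace

variable {V : Type*} [NormedAddCommGroup V] [NormedSpace ℂ V] [OperatorSpace V] {ι κ : Type}
  [Fintype ι] [DecidableEq ι] [Fintype κ] [DecidableEq κ]

theorem matNorm_submatrix_le (x : Matrix κ κ V) {e f : ι → κ} (he : Function.Injective e)
    (hf : Function.Injective f) :
    MatrixNorms.matNorm (x.submatrix e f) ≤ MatrixNorms.matNorm x := by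
  rw [submatrix_eq_scalarMulMul]
  calc _ ≤ 1 * MatrixNorms.matNorm x * 1 := by
        refine (matNorm_scalarMulMul_le _ x _).trans ?_
        gcongr
        exacts [ENNReal.coe_le_one_iff.2 (l2_opNorm_one_submatrix_le_one he),
          ENNReal.coe_le_one_iff.2 (l2_opNorm_one_submatrix_id_le_one hf)]
    _ = _ := by ring

theorem enorm_apply_le (x : Matrix κ κ V) (k l : κ) : ‖x k l‖ₑ ≤ MatrixNorms.matNorm x := by
  rw [← matNorm_single]
  exact matNorm_submatrix_le x (Function.injective_of_subsingleton fun _ : Fin 1 => k)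
    (Function.injective_of_subsingleton fun _ : Fin 1 => l)

theorem matNorm_smul_le (c : ℂ) (x : Matrix κ κ V) :
    MatrixNorms.matNorm (c • x) ≤ ‖c‖ₑ * MatrixNorms.matNorm x := by
  have h : c • x = scalarMulMul (c • (1 : Matrix κ κ ℂ)) x 1 := by
    ext i j
    simp [scalarMulMul, Matrix.one_apply, ite_smul]
  have hone : ‖(1 : Matrix κ κ ℂ)‖ₑ ≤ 1 := ENNReal.coe_le_one_iff.2 l2_opNorm_one_le_one
  calc _ ≤ ‖c • (1 : Matrix κ κ ℂ)‖ₑ * MatrixNorms.matNorm x * ‖(1 : Matrix κ κ ℂ)‖ₑ :=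
        h ▸ matNorm_scalarMulMul_le _ x _
    _ ≤ (‖c‖ₑ * 1) * MatrixNorms.matNorm x * 1 := by
        rw [enorm_smul]
        gcongr
    _ = _ := by ring

theorem matNorm_ne_top (x : Matrix κ κ V) : MatrixNorms.matNorm x ≠ ∞ := by
  induction x using Matrix.induction_on' with
  | h_zero =>
    refine ne_top_of_le_ne_top ENNReal.zero_ne_top ?_
    simpa using matNorm_smul_le (0 : ℂ) (0 : Matrix κ κ V)
  | h_add x y hx hy =>
    exact ne_top_of_le_ne_top (ENNReal.add_ne_top.2 ⟨hx, hy⟩) (matNorm_add_le x y)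
  | h_std_basis k l v =>
    have h : Matrix.single k l v = scalarMulMul (Matrix.single k 0 1)
        (Matrix.of fun _ _ : Fin 1 => v) (Matrix.single 0 l 1) := by
      ext i j
      by_cases hk : k = i <;> simp [scalarMulMul, Matrix.single_apply, hk]
    rw [h]
    refine ne_top_of_le_ne_top ?_ (matNorm_scalarMulMul_le _ _ _)
    rw [matNorm_single]
    exact ENNReal.mul_ne_top (ENNReal.mul_ne_top enorm_ne_top enorm_ne_top) enorm_ne_top

theorem enorm_pairing_le_of_matNorm_le_one (φ : Matrix ι ι (StrongDual ℂ V)) {x : Matrix κ κ V}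
    (hx : MatrixNorms.matNorm x ≤ 1) :
    ‖(Matrix.of fun p q : ι × κ => φ p.1 q.1 (x p.2 q.2))‖ₑ ≤ MatrixNorms.matNorm φ := by
  let e : κ ≃ Fin (Fintype.card κ) := Fintype.equivFin κ
  let y := x.submatrix e.symm e.symm
  have hy : MatrixNorms.matNorm y ≤ 1 :=
    (matNorm_submatrix_le x e.symm.injective e.symm.injective).trans hx
  let f : ι × κ ≃ ι × Fin (Fintype.card κ) := (Equiv.refl ι).prodCongr e
  have h : (Matrix.of fun p q : ι × κ => φ p.1 q.1 (x p.2 q.2)) =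
      (Matrix.of fun p q : ι × Fin (Fintype.card κ) => φ p.1 q.1 (y p.2 q.2)).submatrix f f := by
    ext p q
    simp [y, f]
  refine le_trans ?_ (le_iSup₂_of_le (Fintype.card κ) y (le_iSup_of_le hy le_rfl))
  rw [h, enorm_le_iff_norm_le]
  exact l2_opNorm_submatrix_le _ f.injective

theorem enorm_pairing_le (φ : Matrix ι ι (StrongDual ℂ V)) (x : Matrix κ κ V) :
    ‖(Matrix.of fun p q : ι × κ => φ p.1 q.1 (x p.2 q.2))‖ₑ ≤
      MatrixNorms.matNorm φ * MatrixNorms.matNorm x := by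
  by_cases h0 : MatrixNorms.matNorm x = 0
  · have hx : x = 0 := by
      ext k l
      simpa [h0] using enorm_apply_le x k l
    have : (Matrix.of fun p q : ι × κ => φ p.1 q.1 (x p.2 q.2)) = 0 := by
      ext
      simp [hx]
    simp [this]
  · let r : ℂ := (MatrixNorms.matNorm x).toReal
    have hr0 : r ≠ 0 := Complex.ofReal_ne_zero.2 (ENNReal.toReal_ne_zero.2 ⟨h0, matNorm_ne_top x⟩)
    have hr : ‖r‖ₑ = MatrixNorms.matNorm x := by
      rw [← ofReal_norm, Complex.norm_of_nonneg ENNReal.toReal_nonneg,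
        ENNReal.ofReal_toReal (matNorm_ne_top x)]
    have hunit : MatrixNorms.matNorm (r⁻¹ • x) ≤ 1 := by
      refine (matNorm_smul_le _ x).trans_eq ?_
      rw [enorm_inv hr0, hr, ENNReal.inv_mul_cancel h0 (matNorm_ne_top x)]
    have hscale : (Matrix.of fun p q : ι × κ => φ p.1 q.1 (x p.2 q.2)) =
        r • Matrix.of fun p q : ι × κ => φ p.1 q.1 ((r⁻¹ • x) p.2 q.2) := by
      ext
      simp [hr0]
    rw [hscale, enorm_smul, hr, mul_comm]
    gcongr
    exact enorm_pairing_le_of_matNorm_le_one φ hunit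

instance instSubmodule (F : Submodule ℂ V) : OperatorSpace F where
  matNorm x := MatrixNorms.matNorm (x.map F.subtype)
  matNorm_single v := matNorm_single (v : V)
  matNorm_add_le x y := by
    refine le_of_eq_of_le (congrArg _ ?_) (matNorm_add_le (x.map F.subtype) (y.map F.subtype))
    ext
    simp
  matNorm_scalarMulMul_le α x β := by
    refine le_of_eq_of_le (congrArg _ ?_) (matNorm_scalarMulMul_le α (x.map F.subtype) β)
    ext
    simp [scalarMulMul]
  matNorm_fromBlocks x y := by
    refine (congrArg _ ?_).trans (matNorm_fromBlocks (x.map F.subtype) (y.map F.subtype))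
    rw [Matrix.fromBlocks_map, Matrix.map_zero _ (map_zero _), Matrix.map_zero _ (map_zero _)]

end OperatorSpace

/-! ### The group C*-algebra -/

section

variable {G : Type u} [Group G] [TopologicalSpace G] [IsTopologicalGroup G]
  [LocallyCompactSpace G] [MeasurableSpace G] [BorelSpace G] {ι κ : Type} [Fintype ι]
  [DecidableEq ι] [Fintype κ] [DecidableEq κ]

theorem UnitaryRep.norm_extend_le (ρ : UnitaryRep G) (a : GroupCStar G) : ‖ρ.extend a‖ ≤ ‖a‖ := by
  induction a using UniformSpace.Completion.induction_on with
  | hp => exact isClosed_le (by fun_prop) (by fun_prop)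
  | ih f =>
    rw [ρ.extend_coe, UniformSpace.Completion.norm_coe]
    exact ρ.norm_integrate_le_norm f

namespace GroupCStar

theorem norm_le {a : GroupCStar G} {C : ℝ} (h : ∀ ρ : UnitaryRep G, ‖ρ.extend a‖ ≤ C) :
    ‖a‖ ≤ C := by
  refine le_of_forall_pos_le_add fun ε hε => ?_
  obtain ⟨f, hf⟩ := UniformSpace.Completion.denseRange_coe.exists_dist_lt a (half_pos hε)
  rw [dist_eq_norm] at hf
  have hnorm : ‖(f : GroupCStar G)‖ ≤ C + ε / 2 := by
    rw [UniformSpace.Completion.norm_coe]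
    refine PreGroupCStar.norm_le fun ρ => ?_
    rw [← ρ.extend_coe, ← sub_sub_cancel a (f : GroupCStar G), map_sub]
    exact (norm_sub_le _ _).trans (add_le_add (h ρ) ((ρ.norm_extend_le _).trans hf.le))
  linarith [norm_le_norm_sub_add a (f : GroupCStar G)]

theorem ext_extend {a b : GroupCStar G} (h : ∀ ρ : UnitaryRep G, ρ.extend a = ρ.extend b) :
    a = b := by
  rw [← sub_eq_zero, ← norm_le_zero_iff]
  exact norm_le fun ρ => by rw [map_sub, h, sub_self, norm_zero]

theorem enorm_eq_iSup (a : GroupCStar G) : ‖a‖ₑ = ⨆ ρ : UnitaryRep G, ‖ρ.extend a‖ₑ := by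
  refine le_antisymm ?_ (iSup_le fun ρ => enorm_le_iff_norm_le.2 (ρ.norm_extend_le a))
  by_cases htop : ⨆ ρ : UnitaryRep G, ‖ρ.extend a‖ₑ = ∞
  · exact htop ▸ le_top
  · rw [← ofReal_norm, ENNReal.ofReal_le_iff_le_toReal htop]
    refine norm_le fun ρ => ?_
    rw [← ENNReal.ofReal_le_iff_le_toReal htop, ofReal_norm]
    exact le_iSup (fun ρ : UnitaryRep G => ‖ρ.extend a‖ₑ) ρ

theorem enorm_opMatrix_le_matNorm (a : Matrix ι ι (GroupCStar G)) (ρ : UnitaryRep G) :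
    ‖opMatrix (a.map ρ.extend)‖ₑ ≤ MatrixNorms.matNorm a :=
  le_iSup (fun ρ : UnitaryRep G => ‖opMatrix (a.map ρ.extend)‖ₑ) ρ

theorem matNorm_le {a : Matrix ι ι (GroupCStar G)} {C : ℝ≥0∞}
    (h : ∀ ρ : UnitaryRep G, ‖opMatrix (a.map ρ.extend)‖ₑ ≤ C) : MatrixNorms.matNorm a ≤ C :=
  iSup_le h

instance instOperatorSpace : OperatorSpace (GroupCStar G) where
  matNorm_single v := by
    rw [enorm_eq_iSup]
    exact iSup_congr fun ρ =>
      congrArg ENNReal.ofNNReal (NNReal.eq (norm_opMatrix_single (ρ.extend v)))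
  matNorm_add_le x y := matNorm_le fun ρ => by
    have : (x + y).map ρ.extend = x.map ρ.extend + y.map ρ.extend := by ext; simp
    rw [this, opMatrix_add]
    exact (enorm_add_le _ _).trans
      (add_le_add (enorm_opMatrix_le_matNorm x ρ) (enorm_opMatrix_le_matNorm y ρ))
  matNorm_scalarMulMul_le α x β := matNorm_le fun ρ => by
    have : (scalarMulMul α x β).map ρ.extend = scalarMulMul α (x.map ρ.extend) β := by
      ext; simp [scalarMulMul]
    calc ‖opMatrix ((scalarMulMul α x β).map ρ.extend)‖ₑ
        ≤ ‖α‖ₑ * ‖opMatrix (x.map ρ.extend)‖ₑ * ‖β‖ₑ := by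
          simp only [this, enorm_eq_nnnorm, ← ENNReal.coe_mul]
          exact ENNReal.coe_le_coe.2 (norm_opMatrix_scalarMulMul_le α (x.map ρ.extend) β)
      _ ≤ _ := by gcongr; exact enorm_opMatrix_le_matNorm x ρ
  matNorm_fromBlocks x y := by
    refine Eq.trans ?_ iSup_sup_eq
    refine iSup_congr fun ρ => ?_
    rw [Matrix.fromBlocks_map, Matrix.map_zero _ (map_zero _), Matrix.map_zero _ (map_zero _)]
    rw [enorm_eq_nnnorm, enorm_eq_nnnorm, enorm_eq_nnnorm, ← ENNReal.coe_max, ENNReal.coe_inj]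
    exact NNReal.eq (norm_opMatrix_fromBlocks (x.map ρ.extend) (y.map ρ.extend))

theorem matNorm_kronecker_le (c : Matrix ι ι ℂ) (x : Matrix κ κ (GroupCStar G)) :
    MatrixNorms.matNorm (Matrix.of fun p q : ι × κ => c p.1 q.1 • x p.2 q.2) ≤
      ‖c‖ₑ * MatrixNorms.matNorm x := matNorm_le fun ρ => by
  have : (Matrix.of fun p q : ι × κ => c p.1 q.1 • x p.2 q.2).map ρ.extend =
      Matrix.of fun p q : ι × κ => c p.1 q.1 • (x.map ρ.extend) p.2 q.2 := by
    ext; simp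
  calc ‖opMatrix ((Matrix.of fun p q : ι × κ => c p.1 q.1 • x p.2 q.2).map ρ.extend)‖ₑ
      ≤ ‖c‖ₑ * ‖opMatrix (x.map ρ.extend)‖ₑ := by
        simp only [this, enorm_eq_nnnorm, ← ENNReal.coe_mul]
        exact ENNReal.coe_le_coe.2 (norm_opMatrix_kronecker_le c (x.map ρ.extend))
    _ ≤ _ := by gcongr; exact enorm_opMatrix_le_matNorm x ρ

end GroupCStar

end

/-! ### Tensor products and the action of `B(G)` on `C*(G)` -/

theorem exists_orthonormal_expansion {E ι : Type*} [NormedAddCommGroup E]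
    [InnerProductSpace ℂ E] [Finite ι] (ξ : ι → E) :
    ∃ (n : ℕ) (e : Fin n → E), Orthonormal ℂ e ∧ ∀ i, ∑ k, inner ℂ (e k) (ξ i) • e k = ξ i := by
  let V : Submodule ℂ E := Submodule.span ℂ (Set.range ξ)
  have : FiniteDimensional ℂ V := FiniteDimensional.span_of_finite ℂ (Set.finite_range ξ)
  let b := stdOrthonormalBasis ℂ V
  refine ⟨_, fun k => b k, b.orthonormal.comp_linearIsometry V.subtypeₗᵢ, fun i => ?_⟩
  simpa using congrArg V.subtype (b.sum_repr' ⟨ξ i, Submodule.subset_span ⟨i, rfl⟩⟩)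

namespace UnitaryRep

section

variable {G : Type u} [Group G] [TopologicalSpace G]

/-- The elementary tensors in the space of `ρ ⊗ σ`, as a continuous bilinear map. -/
def tmul (ρ σ : UnitaryRep G) : ρ.H →L[ℂ] σ.H →L[ℂ] (ρ.tensor σ).H :=
  ((ContinuousLinearMap.compL ℂ σ.H (ρ.H ⊗[ℂ] σ.H) (UniformSpace.Completion (ρ.H ⊗[ℂ] σ.H)))
    UniformSpace.Completion.toComplL).comp (TensorProduct.mkL ℂ ρ.H σ.H)

variable (ρ σ : UnitaryRep G)

theorem tmul_apply (x : ρ.H) (y : σ.H) : ρ.tmul σ x y =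
    ((x ⊗ₜ[ℂ] y : ρ.H ⊗[ℂ] σ.H) : UniformSpace.Completion (ρ.H ⊗[ℂ] σ.H)) := rfl

theorem inner_tmul (x x' : ρ.H) (y y' : σ.H) :
    inner ℂ (ρ.tmul σ x y) (ρ.tmul σ x' y') = inner ℂ x x' * inner ℂ y y' :=
  (UniformSpace.Completion.inner_coe _ _).trans (TensorProduct.inner_tmul ..)

theorem tensor_π_tmul (s : G) (x : ρ.H) (y : σ.H) :
    (ρ.tensor σ).π s (ρ.tmul σ x y) = ρ.tmul σ (ρ.π s x) (σ.π s y) :=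
  (ContinuousLinearMap.completion_apply_coe _ _).trans (by simp [tmul_apply])

theorem tensor_induction {p : (ρ.tensor σ).H → Prop} (hp : IsClosed {z | p z}) (h0 : p 0)
    (ht : ∀ x y, p (ρ.tmul σ x y)) (ha : ∀ z w, p z → p w → p (z + w)) (z : (ρ.tensor σ).H) :
    p z := by
  refine UniformSpace.Completion.induction_on (α := ρ.H ⊗[ℂ] σ.H) (p := p) z hp fun w => ?_
  induction w using TensorProduct.induction_on with
  | zero => exact h0
  | tmul x y => exact ht x y
  | add x y hx hy =>
    have := ha _ _ hx hy
    exact (UniformSpace.Completion.coe_add x y) ▸ this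

theorem norm_sum_tmul_sq {N : Type*} [Fintype N] {e : N → ρ.H} (he : Orthonormal ℂ e)
    (y : N → σ.H) : ‖∑ k, ρ.tmul σ (e k) (y k)‖ ^ 2 = ∑ k, ‖y k‖ ^ 2 := by
  classical
  have h : inner ℂ (∑ k, ρ.tmul σ (e k) (y k)) (∑ k, ρ.tmul σ (e k) (y k)) =
      ((∑ k, ‖y k‖ ^ 2 : ℝ) : ℂ) := by
    rw [sum_inner]
    simp only [inner_sum, inner_tmul, orthonormal_iff_ite.1 he, ite_mul, one_mul, zero_mul,
      Finset.sum_ite_eq, Finset.mem_univ, if_true, inner_self_eq_norm_sq_to_K]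
    simp
  rw [inner_self_eq_norm_sq_to_K] at h
  exact Complex.ofReal_injective (by simpa using h)

/-- The coefficient `⟨π(·)ξ, η⟩` as an element of the Fourier-Stieltjes algebra. -/
def coefficient (ξ η : ρ.H) : FourierStieltjes G := ⟨ρ.coeff ξ η, ρ, ξ, η, rfl⟩

theorem toFun_coefficient (ξ η : ρ.H) :
    FourierStieltjes.toFun (ρ.coefficient ξ η) = ρ.coeff ξ η := rfl

theorem continuous_coeff (ξ η : ρ.H) : Continuous (ρ.coeff ξ η) :=
  continuous_const.inner (ρ.continuous_apply ξ)

end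

end UnitaryRep

namespace FourierStieltjes

section

variable {G : Type u} [Group G] [TopologicalSpace G]

theorem toFun_injective : Function.Injective (toFun : FourierStieltjes G →ₐ[ℂ] (G → ℂ)) :=
  Subtype.val_injective

theorem exists_coefficient (u : FourierStieltjes G) :
    ∃ (ρ : UnitaryRep G) (ξ η : ρ.H), u = ρ.coefficient ξ η := by
  obtain ⟨ρ, ξ, η, h⟩ := exists_coeff u
  exact ⟨ρ, ξ, η, toFun_injective h⟩

theorem coefficient_mul_coefficient (ρ σ : UnitaryRep G) (ξ η : ρ.H) (ξ' η' : σ.H) :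
    ρ.coefficient ξ η * σ.coefficient ξ' η' =
      (ρ.tensor σ).coefficient (ρ.tmul σ ξ ξ') (ρ.tmul σ η η') :=
  toFun_injective (funext fun s => (ρ.coeff_tensor σ ξ η ξ' η' s).symm)

theorem continuous_toFun (u : FourierStieltjes G) : Continuous (toFun u) := by
  obtain ⟨ρ, ξ, η, h⟩ := exists_coeff u
  exact h ▸ ρ.continuous_coeff ξ η

/-- Pointwise multiplication of functions of compact support with elements of `B(G)`. -/
def mulPre (u : FourierStieltjes G) : PreGroupCStar G →ₗ[ℂ] PreGroupCStar G where
  toFun f := (PreGroupCStar.toCc G).symm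
    { toFun := fun s => toFun u s * PreGroupCStar.toCc G f s
      continuous_toFun := (continuous_toFun u).mul (PreGroupCStar.toCc G f).continuous
      hasCompactSupport' := (PreGroupCStar.toCc G f).hasCompactSupport.mul_left }
  map_add' f g := by
    apply (PreGroupCStar.toCc G).injective
    ext s
    simp [mul_add]
  map_smul' c f := by
    apply (PreGroupCStar.toCc G).injective
    ext s
    simp [mul_left_comm]

theorem toCc_mulPre (u : FourierStieltjes G) (f : PreGroupCStar G) (s : G) :
    PreGroupCStar.toCc G (mulPre u f) s = toFun u s * PreGroupCStar.toCc G f s := rfl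

theorem mulPre_eq_self {u : FourierStieltjes G} {f : PreGroupCStar G}
    (hu : ∀ s ∈ tsupport (PreGroupCStar.toCc G f), toFun u s = 1) : mulPre u f = f := by
  apply (PreGroupCStar.toCc G).injective
  ext s
  rw [toCc_mulPre]
  by_cases hs : s ∈ tsupport (PreGroupCStar.toCc G f)
  · rw [hu s hs, one_mul]
  · rw [image_eq_zero_of_notMem_tsupport hs, mul_zero]

end

variable {G : Type u} [Group G] [TopologicalSpace G] [IsTopologicalGroup G]
  [LocallyCompactSpace G] [MeasurableSpace G] [BorelSpace G]

theorem functional_coefficient (ρ : UnitaryRep G) (ξ η : ρ.H) (a : GroupCStar G) :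
    functional (ρ.coefficient ξ η) a = inner ℂ η (ρ.extend a ξ) :=
  functional_eq_inner _ ρ ξ η rfl a

theorem ext_functional {a b : GroupCStar G}
    (h : ∀ u : FourierStieltjes G, functional u a = functional u b) : a = b :=
  GroupCStar.ext_extend fun ρ => ContinuousLinearMap.ext fun ξ => ext_inner_left ℂ fun η => by
    rw [← functional_coefficient, h, functional_coefficient]

theorem inner_integrate_mulPre (ρ σ : UnitaryRep G) (ξ η : ρ.H) (ξ' η' : σ.H)
    (f : PreGroupCStar G) :
    inner ℂ η' (σ.integrate (PreGroupCStar.toCc G (mulPre (ρ.coefficient ξ η) f)) ξ') =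
      inner ℂ (ρ.tmul σ η η')
        ((ρ.tensor σ).integrate (PreGroupCStar.toCc G f) (ρ.tmul σ ξ ξ')) := by
  rw [UnitaryRep.inner_integrate, UnitaryRep.inner_integrate]
  congr 1
  ext s
  rw [toCc_mulPre, ρ.toFun_coefficient]
  have := ρ.coeff_tensor σ ξ η ξ' η' s
  rw [← UnitaryRep.tmul_apply, ← UnitaryRep.tmul_apply] at this
  rw [this]
  ring

theorem norm_mulPre_coefficient_le (ρ : UnitaryRep G) (ξ η : ρ.H) (f : PreGroupCStar G) :
    ‖mulPre (ρ.coefficient ξ η) f‖ ≤ ‖ξ‖ * ‖η‖ * ‖f‖ := by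
  refine PreGroupCStar.norm_le fun σ => ?_
  have hn : ∀ (x : ρ.H) (y : σ.H), ‖ρ.tmul σ x y‖ = ‖x‖ * ‖y‖ := fun x y =>
    (UniformSpace.Completion.norm_coe _).trans (TensorProduct.norm_tmul x y)
  refine ContinuousLinearMap.opNorm_le_of_re_inner_le (𝕜 := ℂ)
    (mul_nonneg (by positivity) (norm_nonneg f)) fun ξ' η' hξ' hη' => ?_
  calc _ ≤ ‖ρ.tmul σ η η'‖ * (‖f‖ * ‖ρ.tmul σ ξ ξ'‖) := by
        rw [inner_re_symm, inner_integrate_mulPre]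
        exact ((RCLike.re_le_norm _).trans (norm_inner_le_norm _ _)).trans
          (mul_le_mul_of_nonneg_left (ContinuousLinearMap.le_of_opNorm_le _
            ((ρ.tensor σ).norm_integrate_le_norm f) _) (norm_nonneg _))
    _ = _ := by rw [hn, hn, hξ', hη']; ring

theorem exists_bound_mulPre (u : FourierStieltjes G) :
    ∃ C, ∀ f : PreGroupCStar G, ‖mulPre u f‖ ≤ C * ‖f‖ := by
  obtain ⟨ρ, ξ, η, rfl⟩ := exists_coefficient u
  exact ⟨_, norm_mulPre_coefficient_le ρ ξ η⟩

/-- Multiplication with `u ∈ B(G)` on `C*(G)`: the predual of multiplication with `u` on `B(G)`. -/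
def mulOp (u : FourierStieltjes G) : GroupCStar G →L[ℂ] GroupCStar G :=
  ((UniformSpace.Completion.toComplL : PreGroupCStar G →L[ℂ] GroupCStar G).comp
    ((mulPre u).mkContinuousOfExistsBound (exists_bound_mulPre u))).extend
    (UniformSpace.Completion.toComplL : PreGroupCStar G →L[ℂ] GroupCStar G)

theorem mulOp_coe (u : FourierStieltjes G) (f : PreGroupCStar G) :
    mulOp u (f : GroupCStar G) = (mulPre u f : PreGroupCStar G) :=
  ContinuousLinearMap.extend_eq _ UniformSpace.Completion.denseRange_coe
    (UniformSpace.Completion.isUniformInducing_coe _) f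

theorem norm_mulOp_coefficient_le (ρ : UnitaryRep G) (ξ η : ρ.H) (a : GroupCStar G) :
    ‖mulOp (ρ.coefficient ξ η) a‖ ≤ ‖ξ‖ * ‖η‖ * ‖a‖ := by
  induction a using UniformSpace.Completion.induction_on with
  | hp => exact isClosed_le (by fun_prop) (by fun_prop)
  | ih f =>
    rw [mulOp_coe, UniformSpace.Completion.norm_coe, UniformSpace.Completion.norm_coe]
    exact norm_mulPre_coefficient_le ρ ξ η f

theorem functional_mulOp (u v : FourierStieltjes G) (a : GroupCStar G) :
    functional v (mulOp u a) = functional (u * v) a := by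
  induction a using UniformSpace.Completion.induction_on with
  | hp => exact isClosed_eq (by fun_prop) (by fun_prop)
  | ih f =>
    rw [mulOp_coe, functional_coe, functional_coe]
    congr 1
    ext s
    rw [toCc_mulPre, map_mul, Pi.mul_apply]
    ring

theorem functional_add (u v : FourierStieltjes G) (a : GroupCStar G) :
    functional (u + v) a = functional u a + functional v a :=
  congrArg (fun φ : StrongDual ℂ (GroupCStar G) => φ a) (toDual.map_add u v)

theorem functional_smul (c : ℂ) (u : FourierStieltjes G) (a : GroupCStar G) :
    functional (c • u) a = c * functional u a :=
  congrArg (fun φ : StrongDual ℂ (GroupCStar G) => φ a) (toDual.map_smul c u)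

theorem mulOp_add (u v : FourierStieltjes G) (a : GroupCStar G) :
    mulOp (u + v) a = mulOp u a + mulOp v a :=
  ext_functional fun w => by
    simp only [map_add, functional_mulOp, add_mul, functional_add]

theorem mulOp_smul (c : ℂ) (u : FourierStieltjes G) (a : GroupCStar G) :
    mulOp (c • u) a = c • mulOp u a :=
  ext_functional fun w => by
    simp only [map_smul, functional_mulOp, smul_mul_assoc, functional_smul, smul_eq_mul]

theorem mulOp_mul (u v : FourierStieltjes G) (a : GroupCStar G) :
    mulOp (u * v) a = mulOp v (mulOp u a) :=
  ext_functional fun w => by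
    simp only [functional_mulOp, mul_assoc]

theorem inner_extend_mulOp (ρ σ : UnitaryRep G) (ξ η : ρ.H) (ξ' η' : σ.H) (a : GroupCStar G) :
    inner ℂ η' (σ.extend (mulOp (ρ.coefficient ξ η) a) ξ') =
      inner ℂ (ρ.tmul σ η η') ((ρ.tensor σ).extend a (ρ.tmul σ ξ ξ')) := by
  rw [← functional_coefficient, functional_mulOp, coefficient_mul_coefficient,
    functional_coefficient]

theorem functional_mulOp_comm (u v : FourierStieltjes G) (a : GroupCStar G) :
    functional v (mulOp u a) = functional u (mulOp v a) := by
  rw [functional_mulOp, functional_mulOp, mul_comm]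

theorem inner_sum_extend_mulOp {N : Type*} [Fintype N] (u : FourierStieltjes G)
    (a : GroupCStar G) (ρ : UnitaryRep G) (e : N → ρ.H) (α β : N → ℂ) :
    inner ℂ (∑ k, α k • e k) (ρ.extend (mulOp u a) (∑ l, β l • e l)) =
      ∑ k, ∑ l, starRingEnd ℂ (α k) *
        functional u (mulOp (ρ.coefficient (e l) (e k)) a) * β l := by
  rw [sum_inner]
  refine Finset.sum_congr rfl fun k _ => ?_
  rw [map_sum, inner_sum]
  refine Finset.sum_congr rfl fun l _ => ?_
  rw [map_smul, inner_smul_left, inner_smul_right, functional_mulOp_comm, functional_coefficient]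
  ring

section

variable {ι κ N : Type} [Fintype ι] [DecidableEq ι] [Fintype κ] [DecidableEq κ] [Fintype N]
  [DecidableEq N]

theorem matNorm_mulOp_coefficient_le (ρ : UnitaryRep G) {e : N → ρ.H} (he : Orthonormal ℂ e)
    (x : Matrix κ κ (GroupCStar G)) :
    MatrixNorms.matNorm (Matrix.of fun p q : κ × N =>
      mulOp (ρ.coefficient (e q.2) (e p.2)) (x p.1 q.1)) ≤ MatrixNorms.matNorm x := by
  refine GroupCStar.matNorm_le fun σ => le_trans ?_
    (GroupCStar.enorm_opMatrix_le_matNorm x (ρ.tensor σ))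
  rw [enorm_le_iff_norm_le]
  let w : (κ × N → σ.H) → PiLp 2 (fun _ : κ => (ρ.tensor σ).H) := fun z =>
    WithLp.toLp 2 fun p => ∑ k, ρ.tmul σ (e k) (z (p, k))
  have hw : ∀ z : PiLp 2 (fun _ : κ × N => σ.H), ‖w z‖ = ‖z‖ := fun z => by
    rw [← sq_eq_sq₀ (norm_nonneg _) (norm_nonneg _), PiLp.norm_sq_eq_of_L2,
      PiLp.norm_sq_eq_of_L2, Fintype.sum_prod_type]
    exact Finset.sum_congr rfl fun p _ => ρ.norm_sum_tmul_sq σ he _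
  refine norm_opMatrix_le_of_inner_le _ (norm_nonneg _) fun ξ η hξ hη => ?_
  have hinner : ∑ p, ∑ q, inner ℂ (η p) (((Matrix.of fun p q : κ × N =>
        mulOp (ρ.coefficient (e q.2) (e p.2)) (x p.1 q.1)).map σ.extend) p q (ξ q)) =
      inner ℂ (w η) (opMatrix (x.map (ρ.tensor σ).extend) (w ξ)) := by
    rw [inner_opMatrix]
    simp only [Fintype.sum_prod_type, Matrix.map_apply, Matrix.of_apply, inner_extend_mulOp, w,
      map_sum, sum_inner, inner_sum]
    refine Finset.sum_congr rfl fun p _ => ?_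
    rw [Finset.sum_comm]
    exact Finset.sum_congr rfl fun q _ => Finset.sum_comm
  rw [hinner]
  refine (norm_inner_le_norm _ _).trans ?_
  rw [hw, hη, one_mul]
  exact ContinuousLinearMap.le_of_opNorm_le_of_le _ le_rfl ((hw ξ).trans_le hξ.le) |>.trans_eq
    (mul_one _)

theorem enorm_functional_mulOp_coefficient_le (u : Matrix ι ι (FourierStieltjes G))
    (x : Matrix κ κ (GroupCStar G)) (ρ : UnitaryRep G) {e : N → ρ.H} (he : Orthonormal ℂ e) :
    ‖(Matrix.of fun p q : ι × κ × N => functional (u p.1 q.1)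
      (mulOp (ρ.coefficient (e q.2.2) (e p.2.2)) (x p.2.1 q.2.1)))‖ₑ ≤
      MatrixNorms.matNorm u * MatrixNorms.matNorm x :=
  (OperatorSpace.enorm_pairing_le (u.map toDual) (Matrix.of fun p q : κ × N =>
    mulOp (ρ.coefficient (e q.2) (e p.2)) (x p.1 q.1))).trans
      (mul_le_mul_right (matNorm_mulOp_coefficient_le ρ he x) _)

/- Expanding `ξ` and `η` in a finite orthonormal family `e` turns the form of `[uᵢⱼ xₖₗ]` into that
of the scalar matrix `[uᵢⱼ(π_{e_t,e_s} xₖₗ)]`, whose norm is controlled by duality. -/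
theorem matNorm_mulOp_le (u : Matrix ι ι (FourierStieltjes G)) (x : Matrix κ κ (GroupCStar G)) :
    MatrixNorms.matNorm (Matrix.of fun p q : ι × κ => mulOp (u p.1 q.1) (x p.2 q.2)) ≤
      MatrixNorms.matNorm u * MatrixNorms.matNorm x := by
  refine GroupCStar.matNorm_le fun ρ => ?_
  by_cases htop : MatrixNorms.matNorm u * MatrixNorms.matNorm x = ∞
  · exact htop ▸ le_top
  rw [← ofReal_norm, ENNReal.ofReal_le_iff_le_toReal htop]
  refine norm_opMatrix_le_of_inner_le _ ENNReal.toReal_nonneg fun ξ η hξ hη => ?_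
  obtain ⟨n, e, he, hexp⟩ := exists_orthonormal_expansion (Sum.elim ξ η)
  let W : Matrix (ι × κ × Fin n) (ι × κ × Fin n) ℂ := Matrix.of fun p q =>
    functional (u p.1 q.1) (mulOp (ρ.coefficient (e q.2.2) (e p.2.2)) (x p.2.1 q.2.1))
  have hW : ‖W‖ ≤ (MatrixNorms.matNorm u * MatrixNorms.matNorm x).toReal := by
    rw [← ENNReal.ofReal_le_iff_le_toReal htop, ofReal_norm]
    exact enorm_functional_mulOp_coefficient_le u x ρ he
  let coord : PiLp 2 (fun _ : ι × κ => ρ.H) → ι × κ × Fin n → ℂ := fun ζ p =>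
    inner ℂ (e p.2.2) (ζ (p.1, p.2.1))
  have hcoord : ∀ ζ, ‖ζ‖ = 1 → √(∑ p, ‖coord ζ p‖ ^ 2) ≤ 1 := fun ζ hζ => by
    rw [Real.sqrt_le_one, ← one_pow 2, ← hζ, PiLp.norm_sq_eq_of_L2]
    simp only [Fintype.sum_prod_type, coord]
    gcongr
    exact he.sum_inner_products_le _
  have hsum : ∑ p, ∑ q, inner ℂ (η p) (((Matrix.of fun p q : ι × κ =>
        mulOp (u p.1 q.1) (x p.2 q.2)).map ρ.extend) p q (ξ q)) =
      ∑ p, ∑ q, starRingEnd ℂ (coord η p) * W p q * coord ξ q := by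
    have hξe : ∀ q, ∑ k, inner ℂ (e k) (ξ q) • e k = ξ q := fun q => hexp (Sum.inl q)
    have hηe : ∀ p, ∑ k, inner ℂ (e k) (η p) • e k = η p := fun p => hexp (Sum.inr p)
    simp only [Matrix.map_apply, Matrix.of_apply, Fintype.sum_prod_type, coord, W]
    refine Finset.sum_congr rfl fun i _ => Finset.sum_congr rfl fun k _ => ?_
    symm
    rw [Finset.sum_comm]
    refine Finset.sum_congr rfl fun j _ => ?_
    rw [Finset.sum_comm]
    refine Finset.sum_congr rfl fun l _ => ?_
    rw [← inner_sum_extend_mulOp, hξe, hηe]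
  rw [hsum]
  calc _ ≤ ‖W‖ * √(∑ q, ‖coord ξ q‖ ^ 2) * √(∑ p, ‖coord η p‖ ^ 2) :=
        norm_sum_star_mul_le W _ _
    _ ≤ (MatrixNorms.matNorm u * MatrixNorms.matNorm x).toReal * 1 * 1 := by
        gcongr
        exacts [hcoord ξ hξ, hcoord η hη]
    _ = _ := by ring

end

end FourierStieltjes

/-! ### Normality of the action -/

theorem exists_compactlySupported_mul_eq_self {X : Type*} [TopologicalSpace X]
    [LocallyCompactSpace X] [R1Space X] (f : C_c(X, ℂ)) :
    ∃ k : C_c(X, ℂ), k * f = f := by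
  obtain ⟨k, hk_one, hk_supp, -, -⟩ := exists_continuousMap_one_of_isCompact_subset_isOpen
    f.hasCompactSupport.isCompact isOpen_univ (Set.subset_univ _)
  refine ⟨⟨⟨fun s => (k s : ℂ), by fun_prop⟩, ?_⟩, ?_⟩
  · exact HasCompactSupport.comp_left (g := fun x : ℝ => (x : ℂ)) hk_supp Complex.ofReal_zero
  · ext s
    by_cases hs : s ∈ tsupport f
    · simp [show k s = 1 from hk_one hs]
    · simp [image_eq_zero_of_notMem_tsupport hs]

section

variable {X : Type*} [TopologicalSpace X] [MeasurableSpace X] [BorelSpace X]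
  (μ : Measure X) [IsFiniteMeasureOnCompacts μ]

theorem memLp_two_of_compactlySupported (f : C_c(X, ℂ)) : MemLp f 2 μ :=
  f.continuous.memLp_of_hasCompactSupport f.hasCompactSupport

/-- The canonical map from `C_c(X)` to `L²(X)`. -/
def ccToLp : C_c(X, ℂ) →ₗ[ℂ] Lp ℂ 2 μ where
  toFun f := (memLp_two_of_compactlySupported μ f).toLp f
  map_add' _ _ := MemLp.toLp_add _ _
  map_smul' _ _ := MemLp.toLp_const_smul _ _

/-- The closure of `C_c(X)` in `L²(X)`, which may be proper as `X` need not be normal. -/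
abbrev L2Closure : Submodule ℂ (Lp ℂ 2 μ) :=
  (LinearMap.range (ccToLp μ)).topologicalClosure

/-- The canonical map from `C_c(X)` to its closure in `L²(X)`. -/
def ccToL2 : C_c(X, ℂ) →ₗ[ℂ] L2Closure μ :=
  (ccToLp μ).codRestrict _ fun f => Submodule.le_topologicalClosure _ ⟨f, rfl⟩

theorem norm_ccToL2 (f : C_c(X, ℂ)) : ‖ccToL2 μ f‖ = (eLpNorm f 2 μ).toReal :=
  Lp.norm_toLp _ (memLp_two_of_compactlySupported μ f)

theorem denseRange_ccToL2 : DenseRange (ccToL2 μ) := by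
  refine Metric.denseRange_iff.2 fun v r hr => ?_
  obtain ⟨_, ⟨f, rfl⟩, hf⟩ := Metric.mem_closure_iff.1 v.2 r hr
  exact ⟨f, hf⟩

theorem norm_ccToL2_star (f : C_c(X, ℂ)) : ‖ccToL2 μ (star f)‖ = ‖ccToL2 μ f‖ := by
  rw [norm_ccToL2, norm_ccToL2]
  exact congrArg _ (eLpNorm_congr_norm_ae (.of_forall fun s => norm_star _))

theorem inner_ccToL2 (f g : C_c(X, ℂ)) :
    inner ℂ (ccToL2 μ f) (ccToL2 μ g) = ∫ s, (star f * g) s ∂μ := by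
  refine (L2.inner_def _ _).trans (integral_congr_ae ?_)
  filter_upwards [(memLp_two_of_compactlySupported μ f).coeFn_toLp,
    (memLp_two_of_compactlySupported μ g).coeFn_toLp] with s hf hg
  change inner ℂ ((memLp_two_of_compactlySupported μ f).toLp f s)
    ((memLp_two_of_compactlySupported μ g).toLp g s) = _
  simp [hf, hg, mul_comm]

theorem integral_norm_mul_le (f g : C_c(X, ℂ)) :
    ∫ s, ‖(f * g) s‖ ∂μ ≤ ‖ccToL2 μ f‖ * ‖ccToL2 μ g‖ := by
  have hmem (h : C_c(X, ℂ)) : MemLp (fun s => ‖h s‖) 2 μ :=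
    (memLp_two_of_compactlySupported μ h).norm
  have hnorm (h : C_c(X, ℂ)) : ‖(hmem h).toLp _‖ = ‖ccToL2 μ h‖ := by
    rw [Lp.norm_toLp, eLpNorm_norm, norm_ccToL2]
  calc ∫ s, ‖(f * g) s‖ ∂μ = inner ℝ ((hmem f).toLp _) ((hmem g).toLp _) := by
        rw [L2.inner_def]
        refine integral_congr_ae ?_
        filter_upwards [(hmem f).coeFn_toLp, (hmem g).coeFn_toLp] with s hf hg
        simp [hf, hg, mul_comm]
    _ ≤ ‖ccToL2 μ f‖ * ‖ccToL2 μ g‖ := by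
        rw [← hnorm f, ← hnorm g]
        exact real_inner_le_norm _ _

theorem exists_inner_ccToL2_eq (ψ : C_c(X, ℂ) →ₗ[ℂ] ℂ)
    (hψ : ∃ C, ∀ f, ‖ψ f‖ ≤ C * ‖ccToL2 μ f‖) :
    ∃ v : L2Closure μ, ∀ f, inner ℂ v (ccToL2 μ f) = ψ f :=
  ⟨(InnerProductSpace.toDual ℂ _).symm (ψ.extendOfNorm (ccToL2 μ)), fun f => by
    rw [InnerProductSpace.toDual_symm_apply]
    exact LinearMap.extendOfNorm_eq (denseRange_ccToL2 μ) hψ f⟩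

end

section

variable {G : Type u} [Group G] [TopologicalSpace G] [IsTopologicalGroup G]
  [LocallyCompactSpace G] [MeasurableSpace G] [BorelSpace G]

namespace PreGroupCStar

theorem norm_mul_le (f g : C_c(G, ℂ)) :
    ‖(toCc G).symm (f * g)‖ ≤ ‖ccToL2 Measure.haar f‖ * ‖ccToL2 Measure.haar g‖ :=
  (PreGroupCStar.norm_le fun ρ => ρ.norm_integrate_le _).trans (integral_norm_mul_le _ f g)

/-- The conjugate linear map `g ↦ g* k` from `C_c(G)` to `C*(G)`, with pointwise conjugation and
multiplication. -/
def starMul (k : C_c(G, ℂ)) : C_c(G, ℂ) →ₛₗ[starRingEnd ℂ] GroupCStar G where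
  toFun g := ((toCc G).symm (star g * k) : PreGroupCStar G)
  map_add' g h := by rw [star_add, add_mul, map_add, UniformSpace.Completion.coe_add]
  map_smul' c g := by
    rw [star_smul, smul_mul_assoc, map_smul, UniformSpace.Completion.coe_smul, starRingEnd_apply]

theorem norm_starMul_le (k g : C_c(G, ℂ)) :
    ‖starMul k g‖ ≤ ‖ccToL2 Measure.haar k‖ * ‖ccToL2 Measure.haar g‖ :=
  calc ‖starMul k g‖ = ‖(toCc G).symm (star g * k)‖ := UniformSpace.Completion.norm_coe _
    _ ≤ _ := (norm_mul_le _ _).trans_eq (by rw [norm_ccToL2_star, mul_comm])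

end PreGroupCStar

namespace FourierStieltjes

open PreGroupCStar (toCc starMul)

theorem exists_functional_eq_inner (k : C_c(G, ℂ)) (v : L2Closure (Measure.haar : Measure G)) :
    ∃ y : GroupCStar G, ∀ u : FourierStieltjes G, functional u y =
      inner ℂ v (ccToL2 Measure.haar (toCc G (mulPre u ((toCc G).symm k)))) := by
  refine ⟨(starMul k).extendOfNorm (ccToL2 Measure.haar) v, fun u => ?_⟩
  have hcont (w : L2Closure (Measure.haar : Measure G)) :
      Continuous fun v : L2Closure (Measure.haar : Measure G) => (inner ℂ v w : ℂ) :=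
    (continuous_subtype_val.inner continuous_const :
      Continuous fun v : L2Closure (Measure.haar : Measure G) =>
        (inner ℂ (v : Lp ℂ 2 (Measure.haar : Measure G)) (w : Lp ℂ 2 Measure.haar) : ℂ))
  induction v using (denseRange_ccToL2 (Measure.haar : Measure G)).induction_on with
  | hp => exact isClosed_eq (by fun_prop) (hcont _)
  | ih g =>
    rw [LinearMap.extendOfNorm_eq (denseRange_ccToL2 _) ⟨_, PreGroupCStar.norm_starMul_le k⟩,
      inner_ccToL2]
    refine (functional_coe u _).trans (integral_congr_ae (.of_forall fun s => ?_))
    simp only [LinearEquiv.apply_symm_apply, CompactlySupportedContinuousMap.mul_apply, toCc_mulPre]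
    ring

/- Choosing `k ∈ C_c(G)` with `k f = f`, one has `φ(u · f) = φ(f (u k))`, which is an `L²`-bounded
functional of `u k`. -/
theorem exists_functional_eq_coe (φ : StrongDual ℂ (GroupCStar G)) (f : PreGroupCStar G) :
    ∃ y : GroupCStar G, ∀ u : FourierStieltjes G, φ (mulOp u (f : GroupCStar G)) =
      functional u y := by
  obtain ⟨k, hk⟩ := exists_compactlySupported_mul_eq_self (toCc G f)
  let ψ : C_c(G, ℂ) →ₗ[ℂ] ℂ := φ.toLinearMap ∘ₗ
    (UniformSpace.Completion.toComplL : PreGroupCStar G →L[ℂ] GroupCStar G).toLinearMap ∘ₗ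
      (toCc G).symm.toLinearMap ∘ₗ LinearMap.mulLeft ℂ (toCc G f)
  have hψ (h : C_c(G, ℂ)) : ‖ψ h‖ ≤
      ‖φ‖ * ‖ccToL2 Measure.haar (toCc G f)‖ * ‖ccToL2 Measure.haar h‖ := by
    refine (φ.le_opNorm _).trans ?_
    rw [mul_assoc]
    gcongr
    exact (UniformSpace.Completion.norm_coe _).trans_le (PreGroupCStar.norm_mul_le _ _)
  obtain ⟨v, hv⟩ := exists_inner_ccToL2_eq _ ψ ⟨_, hψ⟩
  obtain ⟨y, hy⟩ := exists_functional_eq_inner k v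
  refine ⟨y, fun u => ?_⟩
  have hmul : mulPre u f =
      (toCc G).symm (toCc G f * toCc G (mulPre u ((toCc G).symm k))) := by
    refine (toCc G).injective (CompactlySupportedContinuousMap.ext fun s => ?_)
    have hks : k s * toCc G f s = toCc G f s := congrArg (fun h : C_c(G, ℂ) => h s) hk
    rw [LinearEquiv.apply_symm_apply, CompactlySupportedContinuousMap.mul_apply, toCc_mulPre,
      toCc_mulPre, LinearEquiv.apply_symm_apply]
    linear_combination -(toFun u s) * hks
  rw [hy, hv, mulOp_coe, hmul]
  rfl

theorem norm_le_of_forall_functional_eq (φ : StrongDual ℂ (GroupCStar G)) {x y : GroupCStar G}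
    (h : ∀ u : FourierStieltjes G, φ (mulOp u x) = functional u y) : ‖y‖ ≤ ‖φ‖ * ‖x‖ := by
  refine GroupCStar.norm_le fun ρ => ContinuousLinearMap.opNorm_le_of_re_inner_le (𝕜 := ℂ)
    (by positivity) fun ξ η hξ hη => ?_
  calc RCLike.re (inner ℂ (ρ.extend y ξ) η) ≤ ‖inner ℂ η (ρ.extend y ξ)‖ := by
        rw [inner_re_symm]
        exact RCLike.re_le_norm _
    _ = ‖φ (mulOp (ρ.coefficient ξ η) x)‖ := by rw [h, functional_coefficient]
    _ ≤ ‖φ‖ * (‖ξ‖ * ‖η‖ * ‖x‖) := (φ.le_opNorm _).trans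
        (mul_le_mul_of_nonneg_left (norm_mulOp_coefficient_le ρ ξ η x) (norm_nonneg _))
    _ = ‖φ‖ * ‖x‖ := by rw [hξ, hη, one_mul, one_mul]

/- The relation between `x` and `y` is closed and Lipschitz, so its domain is closed; it contains
the dense subspace `C_c(G)`. -/
theorem exists_functional_eq (φ : StrongDual ℂ (GroupCStar G)) (x : GroupCStar G) :
    ∃ y : GroupCStar G, ∀ u : FourierStieltjes G, φ (mulOp u x) = functional u y := by
  let K : Set (GroupCStar G × GroupCStar G) :=
    {p | ∀ u : FourierStieltjes G, φ (mulOp u p.1) = functional u p.2}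
  have hK : IsClosed K := by
    simp only [K, Set.ofPred_forall]
    exact isClosed_iInter fun u => isClosed_eq (by fun_prop) (by fun_prop)
  have : CompleteSpace K := hK.completeSpace_coe
  have hfst : AntilipschitzWith (max 1 ‖φ‖₊) fun p : K => p.1.1 := by
    refine AntilipschitzWith.of_le_mul_dist fun p q => ?_
    rw [Subtype.dist_eq, Prod.dist_eq, NNReal.coe_max, max_mul_of_nonneg _ _ dist_nonneg,
      NNReal.coe_one, one_mul, dist_eq_norm p.1.2, dist_eq_norm p.1.1]
    refine max_le_max le_rfl (norm_le_of_forall_functional_eq φ fun u => ?_)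
    rw [map_sub, map_sub, map_sub, p.2 u, q.2 u]
  have hdense : DenseRange fun p : K => p.1.1 :=
    UniformSpace.Completion.denseRange_coe.mono <| by
      rintro _ ⟨f, rfl⟩
      obtain ⟨y, hy⟩ := exists_functional_eq_coe φ f
      exact ⟨⟨(f, y), hy⟩, rfl⟩
  obtain ⟨⟨⟨_, y⟩, hy⟩, rfl⟩ : x ∈ Set.range fun p : K => p.1.1 :=
    (hfst.isClosed_range (uniformContinuous_fst.comp uniformContinuous_subtype_val)).closure_eq ▸
      hdense x
  exact ⟨y, hy⟩

end FourierStieltjes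

end

/-! ### Property (T) and the Kazhdan projection -/

section

variable {X H : Type*} [TopologicalSpace X] [MeasurableSpace X] [BorelSpace X]
  [NormedAddCommGroup H] {μ : Measure X} [IsFiniteMeasureOnCompacts μ]

theorem integrable_compactlySupported_smul [NormedSpace ℝ H] (f : C_c(X, ℝ)) {w : X → H}
    (hw : Continuous w) : Integrable (fun s => f s • w s) μ :=
  (f.continuous.smul hw).integrable_of_hasCompactSupport f.hasCompactSupport.smul_right

variable [InnerProductSpace ℂ H] [CompleteSpace H] {f : C_c(X, ℝ)} {w : X → H}

theorem integral_mul_norm_sub_sq (hf : ∫ s, f s ∂μ = 1) (hw : Continuous w) :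
    ∫ s, f s * ‖w s - ∫ t, f t • w t ∂μ‖ ^ 2 ∂μ =
      ∫ s, f s * ‖w s‖ ^ 2 ∂μ - ‖∫ t, f t • w t ∂μ‖ ^ 2 := by
  set m := ∫ t, f t • w t ∂μ with hm
  have hexpand (s : X) : f s * ‖w s - m‖ ^ 2 =
      f s * ‖w s‖ ^ 2 - (2 * RCLike.re (inner ℂ m (f s • w s)) - f s * ‖m‖ ^ 2) := by
    rw [@norm_sub_sq ℂ, inner_re_symm, ← Complex.coe_smul, inner_smul_right,
      ← RCLike.ofReal_eq_complex_ofReal, RCLike.re_ofReal_mul]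
    ring
  have h_int := integrable_compactlySupported_smul (μ := μ) f hw
  have hinner : ∫ s, RCLike.re (inner ℂ m (f s • w s)) ∂μ = ‖m‖ ^ 2 := by
    rw [integral_re (h_int.const_inner m), integral_inner h_int, ← hm, inner_self_eq_norm_sq]
  simp only [hexpand]
  rw [integral_sub, integral_sub, integral_const_mul, hinner, integral_mul_const, hf]
  · ring
  · exact (h_int.const_inner m).re.const_mul 2
  · exact integrable_compactlySupported_smul f continuous_const
  · exact integrable_compactlySupported_smul f (by fun_prop)
  · exact ((h_int.const_inner m).re.const_mul 2).sub
      (integrable_compactlySupported_smul f continuous_const)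

theorem norm_integral_smul_sq_le (hf : ∫ s, f s ∂μ = 1) (hf₀ : ∀ s, 0 ≤ f s) (hw : Continuous w) :
    ‖∫ s, f s • w s ∂μ‖ ^ 2 ≤ ∫ s, f s * ‖w s‖ ^ 2 ∂μ := by
  rw [← sub_nonneg, ← integral_mul_norm_sub_sq hf hw]
  exact integral_nonneg fun s => mul_nonneg (hf₀ s) (sq_nonneg _)

end

namespace UnitaryRep

section

variable {G : Type u} [Group G] [TopologicalSpace G] (ρ : UnitaryRep G)

theorem π_mul_apply (s t : G) (ξ : ρ.H) : ρ.π (s * t) ξ = ρ.π s (ρ.π t ξ) := by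
  rw [map_mul]
  rfl

/-- The subspace of the vectors that are invariant under a subgroup. -/
def fixed (N : Subgroup G) : Submodule ℂ ρ.H where
  carrier := {ξ | ∀ s ∈ N, ρ.π s ξ = ξ}
  add_mem' hξ hη s hs := by rw [map_add, hξ s hs, hη s hs]
  zero_mem' s _ := map_zero _
  smul_mem' c ξ hξ s hs := by rw [map_smul, hξ s hs]

theorem isClosed_fixed (N : Subgroup G) : IsClosed (ρ.fixed N : Set ρ.H) := by
  have : (ρ.fixed N : Set ρ.H) = ⋂ s ∈ N, {ξ | ρ.π s ξ = ξ} := by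
    ext ξ
    simp [fixed]
  rw [this]
  exact isClosed_biInter fun s _ => isClosed_eq (ρ.π s).continuous continuous_id

instance (N : Subgroup G) : CompleteSpace (ρ.fixed N) := (ρ.isClosed_fixed N).completeSpace_coe

theorem inner_π_left (s : G) (ξ η : ρ.H) :
    inner ℂ (ρ.π s ξ) η = inner ℂ ξ (ρ.π s⁻¹ η) := by
  rw [← (ρ.π s⁻¹).inner_map_map, ← π_mul_apply]
  simp

theorem inner_π_right_of_mem_fixed {N : Subgroup G} {s : G} (hs : s ∈ N) {ζ : ρ.H}
    (hζ : ζ ∈ ρ.fixed N) (ξ : ρ.H) : inner ℂ ζ (ρ.π s ξ) = inner ℂ ζ ξ := by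
  conv_lhs => rw [← hζ s hs]
  exact (ρ.π s).inner_map_map _ _

theorem π_mem_orthogonal_fixed (s : G) {ξ : ρ.H} (hξ : ξ ∈ (ρ.fixed ⊤)ᗮ) :
    ρ.π s ξ ∈ (ρ.fixed ⊤)ᗮ := fun ζ hζ => by
  rw [ρ.inner_π_right_of_mem_fixed (Subgroup.mem_top s) hζ]
  exact hξ ζ hζ

/-- The subrepresentation on the orthogonal complement of the invariant vectors. -/
def complement : UnitaryRep G :=
  ofIsometry ((ρ.fixed ⊤)ᗮ : Submodule ℂ ρ.H)
    (fun s => ((ρ.π s).toContinuousLinearEquiv.toContinuousLinearMap.comp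
      (ρ.fixed ⊤)ᗮ.subtypeL).codRestrict _ fun ξ => ρ.π_mem_orthogonal_fixed s ξ.2)
    (fun s ξ => (ρ.π s).norm_map ξ)
    (fun ξ => Subtype.ext (by simp))
    (fun s t ξ => Subtype.ext (ρ.π_mul_apply s t ξ))
    (fun ξ => (ρ.continuous_apply ξ).subtype_mk _)

/-- Kazhdan pairs `(Q, ε)`: every unitary representation with a nonzero `(Q, ε)`-invariant vector
has a nonzero invariant vector. Property (T) asks for one with `Q` compact and `0 < ε`. -/
def IsKazhdanPair (Q : Set G) (ε : ℝ) : Prop :=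
  ∀ ρ : UnitaryRep G, (∃ ξ : ρ.H, ξ ≠ 0 ∧ ∀ s ∈ Q, ‖ρ.π s ξ - ξ‖ < ε * ‖ξ‖) →
    ∃ ξ : ρ.H, ξ ≠ 0 ∧ ∀ s, ρ.π s ξ = ξ

variable {ρ} in
theorem IsKazhdanPair.exists_le_norm_π_sub {Q : Set G} {ε : ℝ} (h : IsKazhdanPair Q ε) {ξ : ρ.H}
    (hξ : ξ ∈ (ρ.fixed ⊤)ᗮ) (hξ₀ : ξ ≠ 0) : ∃ s ∈ Q, ε * ‖ξ‖ ≤ ‖ρ.π s ξ - ξ‖ := by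
  by_contra! hlt
  obtain ⟨(ζ : ((ρ.fixed ⊤)ᗮ : Submodule ℂ ρ.H)), hζ₀, hζ⟩ :=
    h ρ.complement ⟨(⟨ξ, hξ⟩ : ((ρ.fixed ⊤)ᗮ : Submodule ℂ ρ.H)),
      fun h => hξ₀ (congrArg Subtype.val h), hlt⟩
  have hfixed : (ζ : ρ.H) ∈ ρ.fixed ⊤ := fun s _ =>
    congrArg (Subtype.val : ((ρ.fixed ⊤)ᗮ : Submodule ℂ ρ.H) → ρ.H) (hζ s)
  exact hζ₀ (Subtype.ext (inner_self_eq_zero.1 (ζ.2 _ hfixed)) : ζ = 0)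

end

variable {G : Type u} [Group G] [TopologicalSpace G] [IsTopologicalGroup G]
  [LocallyCompactSpace G] [MeasurableSpace G] [BorelSpace G]

theorem integrate_comp_starProjection_fixed (ρ : UnitaryRep G) {f : C_c(G, ℂ)}
    (hf : ∫ s, f s ∂(Measure.haar : Measure G) = 1) :
    ρ.integrate f * (ρ.fixed ⊤).starProjection = (ρ.fixed ⊤).starProjection := by
  ext ξ
  change ρ.integrate f ((ρ.fixed ⊤).starProjection ξ) = _
  rw [integrate_apply]
  have hξ (s : G) := (ρ.fixed ⊤).starProjection_apply_mem ξ s (Subgroup.mem_top s)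
  simp only [hξ]
  rw [integral_smul_const, hf, one_smul]

theorem starProjection_fixed_comp_integrate (ρ : UnitaryRep G) {f : C_c(G, ℂ)}
    (hf : ∫ s, f s ∂(Measure.haar : Measure G) = 1) :
    (ρ.fixed ⊤).starProjection * ρ.integrate f = (ρ.fixed ⊤).starProjection := by
  ext ξ
  refine ext_inner_left ℂ fun η => ?_
  change inner ℂ η ((ρ.fixed ⊤).starProjection (ρ.integrate f ξ)) = _
  rw [← Submodule.inner_starProjection_left_eq_right,
    ← Submodule.inner_starProjection_left_eq_right, inner_integrate]
  simp only [coeff, ρ.inner_π_right_of_mem_fixed (Subgroup.mem_top _)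
    ((ρ.fixed ⊤).starProjection_apply_mem η)]
  rw [integral_mul_const, hf, one_mul]

theorem integrate_mem_orthogonal_fixed (ρ : UnitaryRep G) {f : C_c(G, ℂ)}
    (hf : ∫ s, f s ∂(Measure.haar : Measure G) = 1) {ξ : ρ.H} (hξ : ξ ∈ (ρ.fixed ⊤)ᗮ) :
    ρ.integrate f ξ ∈ (ρ.fixed ⊤)ᗮ := by
  rw [← Submodule.starProjection_apply_eq_zero_iff] at hξ ⊢
  rw [← hξ]
  exact congrArg (fun T : ρ.H →L[ℂ] ρ.H => T ξ) (ρ.starProjection_fixed_comp_integrate hf)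

/-- A real function with compact support as a complex one. -/
def ofRealCc (f : C_c(G, ℝ)) : C_c(G, ℂ) where
  toFun s := (f s : ℂ)
  continuous_toFun := Complex.continuous_ofReal.comp f.continuous
  hasCompactSupport' := f.hasCompactSupport.comp_left (g := fun x : ℝ => (x : ℂ)) (by simp)

theorem integrate_ofRealCc (ρ : UnitaryRep G) (f : C_c(G, ℝ)) (ξ : ρ.H) :
    ρ.integrate (ofRealCc f) ξ = ∫ s, f s • ρ.π s ξ ∂(Measure.haar : Measure G) := rfl

theorem integral_ofRealCc {f : C_c(G, ℝ)} (hf : ∫ s, f s ∂(Measure.haar : Measure G) = 1) :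
    ∫ s, ofRealCc f s ∂(Measure.haar : Measure G) = 1 :=
  (integral_ofReal (f := f)).trans (by rw [hf]; exact Complex.ofReal_one)

theorem integral_mul_norm_π_sub_sq (ρ : UnitaryRep G) {f : C_c(G, ℝ)}
    (hf : ∫ s, f s ∂(Measure.haar : Measure G) = 1) (ξ : ρ.H) :
    ∫ s, f s * ‖ρ.π s ξ - ρ.integrate (ofRealCc f) ξ‖ ^ 2 ∂(Measure.haar : Measure G) =
      ‖ξ‖ ^ 2 - ‖ρ.integrate (ofRealCc f) ξ‖ ^ 2 := by
  refine (integral_mul_norm_sub_sq hf (ρ.continuous_apply ξ)).trans ?_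
  simp only [LinearIsometryEquiv.norm_map]
  rw [integral_mul_const, hf, one_mul, integrate_ofRealCc]

theorem π_integrate_ofRealCc_sub (ρ : UnitaryRep G) {f₀ : C_c(G, ℝ)}
    (hf₀ : ∫ s, f₀ s ∂(Measure.haar : Measure G) = 1) (t : G) (ξ η : ρ.H) :
    ρ.π t (ρ.integrate (ofRealCc f₀) ξ) - η =
      ∫ s, f₀ s • (ρ.π (t * s) ξ - η) ∂(Measure.haar : Measure G) := by
  have hc := ρ.continuous_apply ξ
  simp only [smul_sub]
  rw [integral_sub (integrable_compactlySupported_smul f₀ (by fun_prop))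
    (integrable_compactlySupported_smul f₀ continuous_const), integral_smul_const, hf₀, one_smul]
  congr 1
  refine ((ρ.π t).toContinuousLinearEquiv.integral_comp_comm _).symm.trans ?_
  congr 1
  ext s
  rw [π_mul_apply]
  exact (ρ.π t).map_smul (f₀ s : ℂ) _

theorem norm_π_integrate_sub_sq_le (ρ : UnitaryRep G) {f₀ f : C_c(G, ℝ)} (h₀ : ∀ s, 0 ≤ f₀ s)
    (hf₀ : ∫ s, f₀ s ∂(Measure.haar : Measure G) = 1)
    {C : ℝ} {t : G} (hC : ∀ s, f₀ (t⁻¹ * s) ≤ C * f s) (ξ η : ρ.H) :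
    ‖ρ.π t (ρ.integrate (ofRealCc f₀) ξ) - η‖ ^ 2 ≤
      C * ∫ s, f s * ‖ρ.π s ξ - η‖ ^ 2 ∂(Measure.haar : Measure G) := by
  have hc := ρ.continuous_apply ξ
  calc ‖ρ.π t (ρ.integrate (ofRealCc f₀) ξ) - η‖ ^ 2
      ≤ ∫ s, f₀ s * ‖ρ.π (t * s) ξ - η‖ ^ 2 ∂(Measure.haar : Measure G) := by
        rw [π_integrate_ofRealCc_sub ρ hf₀]
        exact norm_integral_smul_sq_le hf₀ h₀ (by fun_prop)
    _ = ∫ s, f₀ (t⁻¹ * s) * ‖ρ.π s ξ - η‖ ^ 2 ∂(Measure.haar : Measure G) := by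
        rw [← integral_mul_left_eq_self (fun s => f₀ (t⁻¹ * s) * ‖ρ.π s ξ - η‖ ^ 2) t]
        simp only [inv_mul_cancel_left]
    _ ≤ ∫ s, C * (f s * ‖ρ.π s ξ - η‖ ^ 2) ∂(Measure.haar : Measure G) := by
        refine integral_mono ?_
          ((integrable_compactlySupported_smul f (by fun_prop)).const_mul C) fun s => ?_
        · exact Continuous.integrable_of_hasCompactSupport (by fun_prop)
            (f₀.hasCompactSupport.comp_homeomorph (Homeomorph.mulLeft t⁻¹)).mul_right
        · exact (mul_le_mul_of_nonneg_right (hC s) (sq_nonneg _)).trans_eq (mul_assoc _ _ _)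
    _ = C * ∫ s, f s * ‖ρ.π s ξ - η‖ ^ 2 ∂(Measure.haar : Measure G) := integral_const_mul _ _

theorem exists_density_of_isCompact {K : Set G} (hK : IsCompact K) (hne : K.Nonempty) :
    ∃ f : C_c(G, ℝ), (∀ s, 0 ≤ f s) ∧ ∫ s, f s ∂(Measure.haar : Measure G) = 1 ∧
      ∃ c > 0, ∀ s ∈ K, c ≤ f s := by
  obtain ⟨k, hkK, hk_supp, -, hk⟩ := exists_continuousMap_one_of_isCompact_subset_isOpen hK
    isOpen_univ (Set.subset_univ _)
  obtain ⟨s₀, hs₀⟩ := hne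
  have h_int : 0 < ∫ s, k s ∂(Measure.haar : Measure G) :=
    k.continuous.integral_pos_of_hasCompactSupport_nonneg_nonzero hk_supp (fun s => (hk s).1)
      (x := s₀) (by rw [hkK hs₀]; exact one_ne_zero)
  refine ⟨⟨⟨fun s => (∫ s, k s ∂(Measure.haar : Measure G))⁻¹ * k s, by fun_prop⟩,
    HasCompactSupport.mul_left hk_supp⟩, fun s => mul_nonneg (by positivity) (hk s).1,
    (integral_const_mul _ _).trans (inv_mul_cancel₀ h_int.ne'),
    (∫ s, k s ∂(Measure.haar : Measure G))⁻¹, by positivity, fun s hs => ?_⟩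
  change _ ≤ _ * k s
  rw [hkK hs, Pi.one_apply, mul_one]

open scoped Pointwise in
theorem exists_dominating_density {Q : Set G} (hQ : IsCompact Q) (hne : Q.Nonempty)
    (f₀ : C_c(G, ℝ)) :
    ∃ (f : C_c(G, ℝ)) (C : ℝ), 0 < C ∧ (∀ s, 0 ≤ f s) ∧
      ∫ s, f s ∂(Measure.haar : Measure G) = 1 ∧ ∀ t ∈ Q, ∀ s, f₀ (t⁻¹ * s) ≤ C * f s := by
  obtain ⟨f, hf, hf_one, c, hc, hcf⟩ := exists_density_of_isCompact
    (K := Q * insert 1 (tsupport f₀)) (hQ.mul (f₀.hasCompactSupport.isCompact.insert 1))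
    (hne.mul (Set.insert_nonempty _ _))
  obtain ⟨M, hM⟩ := f₀.hasCompactSupport.exists_bound_of_continuous f₀.continuous
  have hM₀ : 0 ≤ M := (norm_nonneg _).trans (hM 1)
  refine ⟨f, (M + 1) / c, by positivity, hf, hf_one, fun t ht s => ?_⟩
  by_cases h : f₀ (t⁻¹ * s) = 0
  · rw [h]
    exact mul_nonneg (by positivity) (hf s)
  · have hs : c ≤ f s :=
      hcf s ⟨t, ht, t⁻¹ * s, Set.mem_insert_of_mem _ (subset_tsupport _ h), mul_inv_cancel_left t s⟩
    calc f₀ (t⁻¹ * s) ≤ (M + 1) / c * c := by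
          rw [div_mul_cancel₀ _ hc.ne']
          linarith [(le_abs_self _).trans (hM (t⁻¹ * s))]
      _ ≤ (M + 1) / c * f s := by gcongr

/- If `f` barely moves the norm of `ξ`, then its variance is small, so the dominated translates of
`f₀` send `ξ` close to `f ξ`; in particular `f₀ ξ` would be almost invariant. -/
theorem IsKazhdanPair.norm_integrate_le {Q : Set G} {ε κ C δ : ℝ} (hQ : IsKazhdanPair Q ε)
    {f₀ f : C_c(G, ℝ)} (h₀ : ∀ s, 0 ≤ f₀ s)
    (hf₀ : ∫ s, f₀ s ∂(Measure.haar : Measure G) = 1)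
    (hf : ∫ s, f s ∂(Measure.haar : Measure G) = 1)
    (hC : ∀ t ∈ insert 1 Q, ∀ s, f₀ (t⁻¹ * s) ≤ C * f s) (hC₀ : 0 < C) (hκ : 0 ≤ κ)
    (hδ : 2 * C * δ ≤ κ ^ 2) (hε : 2 * κ < ε * (1 - δ - κ)) (hδκ : δ + κ < 1)
    (ρ : UnitaryRep G) {ξ : ρ.H} (hξ : ξ ∈ (ρ.fixed ⊤)ᗮ) :
    ‖ρ.integrate (ofRealCc f) ξ‖ ≤ (1 - δ) * ‖ξ‖ := by
  by_contra! hlt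
  set η := ρ.integrate (ofRealCc f) ξ
  set η₀ := ρ.integrate (ofRealCc f₀) ξ
  have hξ₀ : 0 < ‖ξ‖ := norm_pos_iff.2 fun h => by simp [η, h] at hlt
  have hvar : C * (‖ξ‖ ^ 2 - ‖η‖ ^ 2) ≤ (κ * ‖ξ‖) ^ 2 := by
    have hη : ((1 - δ) * ‖ξ‖) ^ 2 ≤ ‖η‖ ^ 2 :=
      pow_le_pow_left₀ (mul_nonneg (by linarith) hξ₀.le) hlt.le 2
    calc C * (‖ξ‖ ^ 2 - ‖η‖ ^ 2) ≤ C * (2 * δ * ‖ξ‖ ^ 2) := by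
          gcongr
          nlinarith [sq_nonneg (δ * ‖ξ‖)]
      _ = 2 * C * δ * ‖ξ‖ ^ 2 := by ring
      _ ≤ κ ^ 2 * ‖ξ‖ ^ 2 := by gcongr
      _ = (κ * ‖ξ‖) ^ 2 := by ring
  have hclose : ∀ t ∈ insert 1 Q, ‖ρ.π t η₀ - η‖ ≤ κ * ‖ξ‖ := fun t ht => by
    refine le_of_sq_le_sq ?_ (by positivity)
    refine (ρ.norm_π_integrate_sub_sq_le h₀ hf₀ (hC t ht) ξ η).trans ?_
    rwa [ρ.integral_mul_norm_π_sub_sq hf]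
  have hη₀η : ‖η₀ - η‖ ≤ κ * ‖ξ‖ := by simpa using hclose 1 (Set.mem_insert _ _)
  have hη₀ : (1 - δ - κ) * ‖ξ‖ ≤ ‖η₀‖ := by
    linarith [norm_sub_norm_le η η₀, norm_sub_rev η η₀]
  obtain ⟨t, ht, hle⟩ := hQ.exists_le_norm_π_sub
    (ρ.integrate_mem_orthogonal_fixed (integral_ofRealCc hf₀) hξ)
    (norm_pos_iff.1 (lt_of_lt_of_le (mul_pos (by linarith) hξ₀) hη₀))
  have hmove : ‖ρ.π t η₀ - η₀‖ ≤ 2 * κ * ‖ξ‖ := by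
    linarith [norm_sub_le_norm_sub_add_norm_sub (ρ.π t η₀) η η₀, norm_sub_rev η η₀,
      hclose t (Set.mem_insert_of_mem _ ht)]
  have hε₀ : 0 < ε := by nlinarith
  nlinarith [mul_lt_mul_of_pos_right hε hξ₀, mul_le_mul_of_nonneg_left hη₀ hε₀.le]

theorem exists_spectral_gap (hT : HasPropertyT G) :
    ∃ (f : C_c(G, ℂ)) (r : ℝ), 0 ≤ r ∧ r < 1 ∧ ∫ s, f s ∂(Measure.haar : Measure G) = 1 ∧
      ∀ ρ : UnitaryRep G, ∀ ξ ∈ (ρ.fixed ⊤)ᗮ, ‖ρ.integrate f ξ‖ ≤ r * ‖ξ‖ := by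
  obtain ⟨Q, hQ, ε, hε, hpair⟩ := hT
  obtain ⟨f₀, h₀, hf₀, -⟩ := exists_density_of_isCompact (isCompact_singleton (x := (1 : G)))
    (Set.singleton_nonempty 1)
  obtain ⟨f, C, hC₀, -, hf, hC⟩ :=
    exists_dominating_density (hQ.insert 1) (Set.insert_nonempty _ _) f₀
  obtain ⟨κ, hκ, hκ₁⟩ : ∃ κ : ℝ, 0 < κ ∧ κ ≤ 1 / 4 ∧ 2 * κ < ε * (1 / 2) :=
    ⟨min (1 / 4) (ε / 8), by positivity, min_le_left _ _,
      by linarith [min_le_right (1 / 4) (ε / 8)]⟩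
  obtain ⟨δ, hδ, hδ₁, hδC⟩ : ∃ δ : ℝ, 0 < δ ∧ δ ≤ 1 / 4 ∧ 2 * C * δ ≤ κ ^ 2 := by
    refine ⟨min (1 / 4) (κ ^ 2 / (2 * C)), by positivity, min_le_left _ _, ?_⟩
    rw [← le_div_iff₀' (by positivity)]
    exact min_le_right _ _
  have hεκ : 2 * κ < ε * (1 - δ - κ) := hκ₁.2.trans_le (by gcongr; linarith)
  exact ⟨ofRealCc f, 1 - δ, by linarith, by linarith, integral_ofRealCc hf, fun ρ ξ hξ =>
    IsKazhdanPair.norm_integrate_le hpair h₀ hf₀ hf hC hC₀ hκ.le hδC hεκ (by linarith) ρ hξ⟩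

end UnitaryRep

namespace UnitaryRep

variable {G : Type u} [Group G] [TopologicalSpace G]

open scoped Pointwise in
theorem mem_tsupport_of_mul_ne_zero {f g : C_c(G, ℂ)} {s t : G} (h : f s * g (s⁻¹ * t) ≠ 0) :
    s ∈ tsupport f ∧ t ∈ tsupport f * tsupport g :=
  have hs := subset_tsupport f (left_ne_zero_of_mul h)
  ⟨hs, s, hs, s⁻¹ * t, subset_tsupport g (right_ne_zero_of_mul h), mul_inv_cancel_left s t⟩

variable [IsTopologicalGroup G] [LocallyCompactSpace G] [MeasurableSpace G] [BorelSpace G]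

/-- The convolution product of the functions with compact support. -/
def conv (f g : C_c(G, ℂ)) : C_c(G, ℂ) where
  toFun t := ∫ s, f s * g (s⁻¹ * t) ∂(Measure.haar : Measure G)
  continuous_toFun := by
    rw [← continuousOn_univ]
    refine continuousOn_integral_of_compact_support f.hasCompactSupport.isCompact ?_ ?_
    · exact Continuous.continuousOn (by unfold Function.uncurry; fun_prop)
    · intro t s _ hs
      rw [image_eq_zero_of_notMem_tsupport hs, zero_mul]
  hasCompactSupport' := by
    refine HasCompactSupport.intro
      (f.hasCompactSupport.isCompact.mul g.hasCompactSupport.isCompact) fun t ht => ?_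
    refine integral_eq_zero_of_ae (.of_forall fun s => ?_)
    by_contra hne
    exact ht (mem_tsupport_of_mul_ne_zero hne).2

theorem integrate_conv (ρ : UnitaryRep G) (f g : C_c(G, ℂ)) :
    ρ.integrate (conv f g) = ρ.integrate f * ρ.integrate g := by
  ext ξ
  have hξ := ρ.continuous_apply ξ
  have hsupp : HasCompactSupport
      (Function.uncurry fun t s => (f s * g (s⁻¹ * t)) • ρ.π t ξ) := by
    refine HasCompactSupport.intro
      ((f.hasCompactSupport.isCompact.mul g.hasCompactSupport.isCompact).prod
        f.hasCompactSupport.isCompact) fun ⟨t, s⟩ hts => ?_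
    by_contra hne
    exact hts (mem_tsupport_of_mul_ne_zero (left_ne_zero_of_smul hne)).symm
  have hinner (s : G) : ∫ t, (f s * g (s⁻¹ * t)) • ρ.π t ξ ∂(Measure.haar : Measure G) =
      f s • ρ.π s (ρ.integrate g ξ) := by
    simp only [mul_smul]
    rw [integral_smul, integrate_apply]
    congr 1
    rw [← integral_mul_left_eq_self _ s]
    simp only [inv_mul_cancel_left, π_mul_apply, ← map_smul]
    exact (ρ.π s).toContinuousLinearEquiv.integral_comp_comm _
  calc ρ.integrate (conv f g) ξ
      = ∫ t, ∫ s, (f s * g (s⁻¹ * t)) • ρ.π t ξ ∂(Measure.haar : Measure G)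
          ∂(Measure.haar : Measure G) := by
        rw [integrate_apply]
        exact integral_congr_ae (.of_forall fun t => (integral_smul_const _ _).symm)
    _ = ∫ s, f s • ρ.π s (ρ.integrate g ξ) ∂(Measure.haar : Measure G) := by
        rw [integral_integral_swap_of_hasCompactSupport (by unfold Function.uncurry; fun_prop)
          hsupp]
        simp only [hinner]
    _ = ρ.integrate f (ρ.integrate g ξ) := (integrate_apply ..).symm

/-- `convPow f n` is the convolution power `f ^ (n + 1)`. -/
def convPow (f : C_c(G, ℂ)) : ℕ → C_c(G, ℂ)
  | 0 => f
  | n + 1 => conv f (convPow f n)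

theorem norm_integrate_sub_starProjection_le {ρ : UnitaryRep G} {f : C_c(G, ℂ)} {r : ℝ}
    (hf : ∫ s, f s ∂(Measure.haar : Measure G) = 1) (hr : 0 ≤ r)
    (hgap : ∀ ξ ∈ (ρ.fixed ⊤)ᗮ, ‖ρ.integrate f ξ‖ ≤ r * ‖ξ‖) :
    ‖ρ.integrate f - (ρ.fixed ⊤).starProjection‖ ≤ r := by
  refine ContinuousLinearMap.opNorm_le_bound _ hr fun ξ => ?_
  have hξ : (ρ.integrate f - (ρ.fixed ⊤).starProjection) ξ =
      ρ.integrate f ((ρ.fixed ⊤)ᗮ.starProjection ξ) := by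
    rw [Submodule.starProjection_orthogonal_val, map_sub]
    refine congrArg (ρ.integrate f ξ - ·) ?_
    exact (congrArg (fun T : ρ.H →L[ℂ] ρ.H => T ξ) (ρ.integrate_comp_starProjection_fixed hf)).symm
  rw [hξ]
  calc _ ≤ r * ‖(ρ.fixed ⊤)ᗮ.starProjection ξ‖ := hgap _ (Submodule.starProjection_apply_mem _ _)
    _ ≤ r * ‖ξ‖ := by
        gcongr
        exact Submodule.norm_starProjection_apply_le _ _

theorem integrate_convPow_sub (ρ : UnitaryRep G) {f : C_c(G, ℂ)}
    (hf : ∫ s, f s ∂(Measure.haar : Measure G) = 1) (n : ℕ) :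
    ρ.integrate (convPow f n) - (ρ.fixed ⊤).starProjection =
      (ρ.integrate f - (ρ.fixed ⊤).starProjection) ^ (n + 1) := by
  have hTP := ρ.integrate_comp_starProjection_fixed hf
  have hPT := ρ.starProjection_fixed_comp_integrate hf
  have hPP : (ρ.fixed ⊤).starProjection * (ρ.fixed ⊤).starProjection =
    (ρ.fixed ⊤).starProjection := (ρ.fixed ⊤).isIdempotentElem_starProjection
  induction n with
  | zero => rw [zero_add, pow_one]; rfl
  | succ n ih =>
    have hPS : (ρ.fixed ⊤).starProjection * ρ.integrate (convPow f n) =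
        (ρ.fixed ⊤).starProjection := by
      rw [eq_add_of_sub_eq ih, mul_add, pow_succ', ← mul_assoc, mul_sub, hPT, hPP, sub_self,
        zero_mul, zero_add]
    rw [pow_succ', ← ih, convPow, integrate_conv, mul_sub, sub_mul, sub_mul, hTP, hPS, hPP,
      sub_self, sub_zero]

theorem norm_integrate_convPow_sub_le {ρ : UnitaryRep G} {f : C_c(G, ℂ)} {r : ℝ}
    (hf : ∫ s, f s ∂(Measure.haar : Measure G) = 1) (hr : 0 ≤ r)
    (hgap : ∀ ξ ∈ (ρ.fixed ⊤)ᗮ, ‖ρ.integrate f ξ‖ ≤ r * ‖ξ‖) (n : ℕ) :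
    ‖ρ.integrate (convPow f n) - (ρ.fixed ⊤).starProjection‖ ≤ r ^ (n + 1) := by
  rw [ρ.integrate_convPow_sub hf]
  exact (norm_pow_le' _ n.succ_pos).trans
    (pow_le_pow_left₀ (norm_nonneg _) (norm_integrate_sub_starProjection_le hf hr hgap) _)

end UnitaryRep

namespace GroupCStar

variable {G : Type u} [Group G] [TopologicalSpace G] [IsTopologicalGroup G]
  [LocallyCompactSpace G] [MeasurableSpace G] [BorelSpace G]

/-- Elements of `C*(G)` that act in every unitary representation as the orthogonal projection onto
the invariant vectors. -/
def IsKazhdanProjection (q : GroupCStar G) : Prop :=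
  ∀ ρ : UnitaryRep G, ρ.extend q = (ρ.fixed ⊤).starProjection

theorem exists_isKazhdanProjection (hT : HasPropertyT G) :
    ∃ q : GroupCStar G, q.IsKazhdanProjection := by
  obtain ⟨f, r, hr, hr₁, hf, hgap⟩ := UnitaryRep.exists_spectral_gap hT
  let z (n : ℕ) : GroupCStar G :=
    ((PreGroupCStar.toCc G).symm (UnitaryRep.convPow f n) : PreGroupCStar G)
  have hz (ρ : UnitaryRep G) (n : ℕ) :
      ‖ρ.extend (z n) - (ρ.fixed ⊤).starProjection‖ ≤ r ^ (n + 1) := by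
    rw [UnitaryRep.extend_coe]
    exact UnitaryRep.norm_integrate_convPow_sub_le hf hr (hgap ρ) n
  have hcauchy : CauchySeq z := by
    refine cauchySeq_of_le_geometric r (2 * r) hr₁ fun n => ?_
    rw [dist_eq_norm]
    refine norm_le fun ρ => ?_
    rw [map_sub, ← sub_sub_sub_cancel_right _ _ (ρ.fixed ⊤).starProjection]
    calc _ ≤ r ^ (n + 1) + r ^ (n + 1 + 1) := norm_sub_le_of_le (hz ρ n) (hz ρ (n + 1))
      _ ≤ r ^ (n + 1) + r ^ (n + 1) := by
        refine add_le_add_right ?_ _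
        exact pow_le_pow_of_le_one hr hr₁.le (Nat.le_succ _)
      _ = 2 * r * r ^ n := by ring
  obtain ⟨q, hq⟩ := cauchySeq_tendsto_of_complete hcauchy
  refine ⟨q, fun ρ => tendsto_nhds_unique ((ρ.extend.continuous.tendsto q).comp hq) ?_⟩
  rw [tendsto_iff_norm_sub_tendsto_zero]
  exact squeeze_zero (fun _ => norm_nonneg _) (hz ρ)
    ((tendsto_pow_atTop_nhds_zero_of_lt_one hr hr₁).comp (Filter.tendsto_add_atTop_nat 1))

end GroupCStar

/-! ### Invariant vectors of tensor products -/

theorem apply_eq_zero_of_forall_mem_orthogonal_eigenspace {H : Type*} [NormedAddCommGroup H]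
    [InnerProductSpace ℂ H] [CompleteSpace H] {T : H →L[ℂ] H} (hT : IsCompactOperator T)
    (hsymm : (T : H →ₗ[ℂ] H).IsSymmetric) {ξ : H}
    (hξ : ∀ μ ≠ 0, ξ ∈ (Module.End.eigenspace (T : H →ₗ[ℂ] H) μ)ᗮ) : T ξ = 0 := by
  suffices T ξ ∈ (⨆ μ, Module.End.eigenspace (T : H →ₗ[ℂ] H) μ)ᗮ by
    rwa [ContinuousLinearMap.orthogonalComplement_iSup_eigenspaces_eq_bot hT hsymm] at this
  rw [← Submodule.iInf_orthogonal, Submodule.mem_iInf]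
  intro μ v hv
  have hTv : T v = μ • v := Module.End.mem_eigenspace_iff.1 hv
  calc inner ℂ v (T ξ) = inner ℂ (T v) ξ := (hsymm v ξ).symm
    _ = starRingEnd ℂ μ * inner ℂ v ξ := by rw [hTv, inner_smul_left]
    _ = 0 := by
      rcases eq_or_ne μ 0 with rfl | hμ
      · rw [map_zero, zero_mul]
      · rw [hξ μ hμ v hv, mul_zero]

namespace UnitaryRep

variable {G : Type u} [Group G] [TopologicalSpace G] (ρ σ : UnitaryRep G)

/-- The conjugate-linear slice map `η ↦ (η^* ⊗ 1)ζ` of a vector `ζ` of the tensor product. -/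
def slice : (ρ.tensor σ).H →L[ℂ] ρ.H →SL[starRingEnd ℂ] σ.H :=
  ((ContinuousLinearMap.adjoint (𝕜 := ℂ) (E := σ.H)
    (F := (ρ.tensor σ).H)).toLinearIsometry.toContinuousLinearMap.comp (ρ.tmul σ)).flip

/-- The conjugate-linear slice map `y ↦ (1 ⊗ y^*)ζ` of a vector `ζ` of the tensor product. -/
def slice' : (ρ.tensor σ).H →L[ℂ] σ.H →SL[starRingEnd ℂ] ρ.H :=
  ((ContinuousLinearMap.adjoint (𝕜 := ℂ) (E := ρ.H)
    (F := (ρ.tensor σ).H)).toLinearIsometry.toContinuousLinearMap.comp (ρ.tmul σ).flip).flip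

theorem inner_slice (ζ : (ρ.tensor σ).H) (η : ρ.H) (y : σ.H) :
    inner ℂ y (ρ.slice σ ζ η) = inner ℂ (ρ.tmul σ η y) ζ :=
  ContinuousLinearMap.adjoint_inner_right (ρ.tmul σ η) y ζ

theorem inner_slice' (ζ : (ρ.tensor σ).H) (η : ρ.H) (y : σ.H) :
    inner ℂ η (ρ.slice' σ ζ y) = inner ℂ (ρ.tmul σ η y) ζ :=
  ContinuousLinearMap.adjoint_inner_right ((ρ.tmul σ).flip y) η ζ

theorem slice_tmul (x η : ρ.H) (y : σ.H) :
    ρ.slice σ (ρ.tmul σ x y) η = inner ℂ η x • y :=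
  ext_inner_left ℂ fun z => by rw [inner_slice, inner_tmul, inner_smul_right]

theorem isCompactOperator_slice (ζ : (ρ.tensor σ).H) : IsCompactOperator (ρ.slice σ ζ) := by
  refine ρ.tensor_induction σ (p := fun ζ => IsCompactOperator (ρ.slice σ ζ)) ?_ ?_ ?_ ?_ ζ
  · exact (isClosed_setOfPred_isCompactOperator (σ₁₂ := starRingEnd ℂ) (M₁ := ρ.H)
      (M₂ := σ.H)).preimage (ρ.slice σ).continuous
  · rw [map_zero]
    exact isCompactOperator_zero
  · intro x y
    refine ⟨(fun c : ℂ => c • y) '' Metric.closedBall 0 1,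
      (isCompact_closedBall 0 1).image (by fun_prop), ?_⟩
    have hcont : Continuous fun η : ρ.H => inner ℂ η x := continuous_id.inner continuous_const
    have hball : (fun η : ρ.H => inner ℂ η x) ⁻¹' Metric.ball (0 : ℂ) 1 ∈ nhds (0 : ρ.H) :=
      hcont.continuousAt.preimage_mem_nhds (by simpa using Metric.ball_mem_nhds (0 : ℂ) one_pos)
    filter_upwards [hball] with η hη
    exact ⟨inner ℂ η x, Metric.ball_subset_closedBall hη, (ρ.slice_tmul σ x η y).symm⟩
  · intro z w hz hw
    rw [map_add]
    exact hz.add hw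

/-- The positive compact operator `S^* S`, for the slice map `S` of `ζ`. -/
def sliceSq (ζ : (ρ.tensor σ).H) : ρ.H →L[ℂ] ρ.H := (ρ.slice' σ ζ).comp (ρ.slice σ ζ)

theorem inner_sliceSq (ζ : (ρ.tensor σ).H) (η η' : ρ.H) :
    inner ℂ η' (ρ.sliceSq σ ζ η) = inner ℂ (ρ.slice σ ζ η) (ρ.slice σ ζ η') := by
  rw [inner_slice, ← inner_slice']
  rfl

theorem isCompactOperator_sliceSq (ζ : (ρ.tensor σ).H) : IsCompactOperator (ρ.sliceSq σ ζ) :=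
  (ρ.isCompactOperator_slice σ ζ).continuous_comp (ρ.slice' σ ζ).continuous

theorem isSymmetric_sliceSq (ζ : (ρ.tensor σ).H) :
    (ρ.sliceSq σ ζ : ρ.H →ₗ[ℂ] ρ.H).IsSymmetric := fun η η' => by
  rw [← inner_conj_symm]
  change starRingEnd ℂ (inner ℂ η' (ρ.sliceSq σ ζ η)) = inner ℂ η (ρ.sliceSq σ ζ η')
  rw [inner_sliceSq, inner_sliceSq, inner_conj_symm]

theorem slice_π {ζ : (ρ.tensor σ).H} (hζ : ζ ∈ (ρ.tensor σ).fixed ⊤) (s : G) (η : ρ.H) :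
    ρ.slice σ ζ (ρ.π s η) = σ.π s (ρ.slice σ ζ η) := by
  refine ext_inner_left ℂ fun y => ?_
  obtain ⟨y, rfl⟩ := (σ.π s).surjective y
  rw [inner_slice, ← tensor_π_tmul, inner_π_left, hζ _ (Subgroup.mem_top _),
    (σ.π s).inner_map_map, inner_slice]

theorem sliceSq_π {ζ : (ρ.tensor σ).H} (hζ : ζ ∈ (ρ.tensor σ).fixed ⊤) (s : G) (η : ρ.H) :
    ρ.sliceSq σ ζ (ρ.π s η) = ρ.π s (ρ.sliceSq σ ζ η) := by
  refine ext_inner_left ℂ fun η' => ?_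
  obtain ⟨η', rfl⟩ := (ρ.π s).surjective η'
  rw [inner_sliceSq, slice_π _ _ hζ, slice_π _ _ hζ, (σ.π s).inner_map_map, ← inner_sliceSq,
    (ρ.π s).inner_map_map]

section

variable {ρ} {V : Submodule ℂ ρ.H}

/-- The action of `G` on an invariant subspace. -/
def restrict (hV : ∀ s, ∀ v ∈ V, ρ.π s v ∈ V) : G →* Module.End ℂ V where
  toFun s := ((ρ.π s).toLinearEquiv : ρ.H →ₗ[ℂ] ρ.H).restrict (hV s)
  map_one' := by ext; simp
  map_mul' s t := by ext v; exact ρ.π_mul_apply s t v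

variable [FiniteDimensional ℂ V]

/-- The action of `G` on a finite-dimensional invariant subspace, in an orthonormal basis. -/
def restrictMatrix (hV : ∀ s, ∀ v ∈ V, ρ.π s v ∈ V) :
    G →* Matrix (Fin (Module.finrank ℂ V)) (Fin (Module.finrank ℂ V)) ℂ :=
  (LinearMap.toMatrixOrthonormal (stdOrthonormalBasis ℂ V)).toRingEquiv.toMonoidHom.comp
    (restrict hV)

theorem restrictMatrix_apply (hV : ∀ s, ∀ v ∈ V, ρ.π s v ∈ V) (s : G) :
    restrictMatrix hV s =
      LinearMap.toMatrixOrthonormal (stdOrthonormalBasis ℂ V) (restrict hV s) := rfl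

theorem star_restrict_mul_restrict (hV : ∀ s, ∀ v ∈ V, ρ.π s v ∈ V) (s : G) :
    star (restrict hV s) * restrict hV s = 1 :=
  LinearMap.ext fun _ => ext_inner_left ℂ fun _ =>
    (LinearMap.adjoint_inner_right (restrict hV s) _ _).trans ((ρ.π s).inner_map_map _ _)

theorem restrictMatrix_mem_unitaryGroup (hV : ∀ s, ∀ v ∈ V, ρ.π s v ∈ V) (s : G) :
    restrictMatrix hV s ∈ Matrix.unitaryGroup (Fin (Module.finrank ℂ V)) ℂ := by
  rw [Matrix.mem_unitaryGroup_iff', restrictMatrix_apply, ← map_star, ← map_mul,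
    star_restrict_mul_restrict, map_one]

theorem continuous_restrictMatrix (hV : ∀ s, ∀ v ∈ V, ρ.π s v ∈ V) :
    Continuous (restrictMatrix hV) :=
  continuous_matrix fun i j => by
    simp only [restrictMatrix_apply, LinearMap.toMatrixOrthonormal_apply_apply]
    exact continuous_const.inner ((ρ.continuous_apply _).subtype_mk fun s =>
      hV s _ (stdOrthonormalBasis ℂ V j).2)

theorem le_fixed_ker (hV : ∀ s, ∀ v ∈ V, ρ.π s v ∈ V) : V ≤ ρ.fixed (toUnitaryProduct G).ker := by
  intro v hv s hs
  let φ : G →ₜ* Matrix.unitaryGroup (Fin (Module.finrank ℂ V)) ℂ :=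
    { (restrictMatrix hV).codRestrict _ (restrictMatrix_mem_unitaryGroup hV) with
      continuous_toFun := (continuous_restrictMatrix hV).subtype_mk _ }
  have hφ : φ s = 1 := congrFun (MonoidHom.mem_ker.1 hs) ⟨_, φ⟩
  have hmatrix : restrictMatrix hV s = 1 := congrArg Subtype.val hφ
  have hone : restrict hV s = 1 := by
    rw [restrictMatrix_apply, ← map_one (LinearMap.toMatrixOrthonormal (stdOrthonormalBasis ℂ V))]
      at hmatrix
    exact (LinearMap.toMatrixOrthonormal (stdOrthonormalBasis ℂ V)).toRingEquiv.injective hmatrix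
  exact congrArg Subtype.val (LinearMap.congr_fun hone ⟨v, hv⟩)

end

/- The eigenspaces of the compact operator `sliceSq` are finite-dimensional and invariant. -/
theorem slice_eq_zero {ζ : (ρ.tensor σ).H} (hζ : ζ ∈ (ρ.tensor σ).fixed ⊤) {ξ : ρ.H}
    (hξ : ξ ∈ (ρ.fixed (toUnitaryProduct G).ker)ᗮ) : ρ.slice σ ζ ξ = 0 := by
  have hcomp := ρ.isCompactOperator_sliceSq σ ζ
  have hT : ρ.sliceSq σ ζ ξ = 0 := by
    refine apply_eq_zero_of_forall_mem_orthogonal_eigenspace hcomp (ρ.isSymmetric_sliceSq σ ζ)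
      fun μ hμ => Submodule.orthogonal_le ?_ hξ
    have := ContinuousLinearMap.finite_dimensional_eigenspace hcomp μ hμ
    refine le_fixed_ker fun s v hv => Module.End.mem_eigenspace_iff.2 ?_
    have hTv : ρ.sliceSq σ ζ v = μ • v := Module.End.mem_eigenspace_iff.1 hv
    exact (ρ.sliceSq_π σ hζ s v).trans (by rw [hTv, map_smul])
  rw [← inner_self_eq_zero (𝕜 := ℂ), ← inner_sliceSq, hT, inner_zero_right]

theorem tmul_mem_orthogonal_fixed {ξ : ρ.H} (hξ : ξ ∈ (ρ.fixed (toUnitaryProduct G).ker)ᗮ)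
    (x : σ.H) : ρ.tmul σ ξ x ∈ ((ρ.tensor σ).fixed ⊤)ᗮ := fun ζ hζ => by
  rw [← inner_conj_symm, ← inner_slice, ρ.slice_eq_zero σ hζ hξ, inner_zero_right, map_zero]

end UnitaryRep

/-! ### Quasi-regular and regular representations -/

theorem norm_sum_sq_eq_sum_norm_sq {ι 𝕜 E : Type*} [RCLike 𝕜] [NormedAddCommGroup E]
    [InnerProductSpace 𝕜 E] {v : ι → E} {s : Finset ι}
    (hv : (s : Set ι).Pairwise fun i j => inner 𝕜 (v i) (v j) = 0) :
    ‖∑ i ∈ s, v i‖ ^ 2 = ∑ i ∈ s, ‖v i‖ ^ 2 := by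
  classical
  induction s using Finset.induction_on with
  | empty => simp
  | insert a s ha ih =>
    rw [Finset.coe_insert, Set.pairwise_insert_of_notMem (by exact_mod_cast ha)] at hv
    have horth : inner 𝕜 (v a) (∑ i ∈ s, v i) = 0 := by
      rw [inner_sum]
      exact Finset.sum_eq_zero fun i hi => (hv.2 i hi).1
    rw [Finset.sum_insert ha, Finset.sum_insert ha, ← ih hv.1, sq, sq, sq]
    exact norm_add_sq_eq_norm_sq_add_norm_sq_of_inner_eq_zero _ _ horth

namespace UnitaryRep

section

variable {G : Type u} [Group G] [TopologicalSpace G] [IsTopologicalGroup G]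

open scoped Pointwise in
theorem exists_orthogonal_translates [NoncompactSpace G] (ρ : UnitaryRep G) {w : ρ.H} {K : Set G}
    (hK : IsCompact K) (hw : ∀ s ∉ K, inner ℂ w (ρ.π s w) = 0) (n : ℕ) :
    ∃ S : Finset G, S.card = n ∧
      (S : Set G).Pairwise fun s t => inner ℂ (ρ.π s w) (ρ.π t w) = 0 := by
  classical
  induction n with
  | zero => exact ⟨∅, by simp⟩
  | succ n ih =>
    obtain ⟨S, hS, horth⟩ := ih
    have hcompact : IsCompact (⋃ s ∈ S, s • insert 1 K) :=
      S.isCompact_biUnion fun s _ => (hK.insert 1).smul s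
    obtain ⟨g, hg⟩ := (Set.ne_univ_iff_exists_notMem _).1 hcompact.ne_univ
    simp only [Set.mem_iUnion, not_exists, Set.mem_smul_set_iff_inv_smul_mem, smul_eq_mul] at hg
    have hgS : g ∉ S := fun h => hg g h (by simp)
    have hgorth : ∀ s ∈ S, inner ℂ (ρ.π s w) (ρ.π g w) = 0 := fun s hs => by
      rw [inner_π_left, ← π_mul_apply]
      exact hw _ fun h => hg s hs (Set.mem_insert_of_mem _ h)
    refine ⟨insert g S, by rw [Finset.card_insert_of_notMem hgS, hS], ?_⟩
    rw [Finset.coe_insert]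
    exact horth.insert fun s hs _ => ⟨inner_eq_zero_symm.1 (hgorth s hs), hgorth s hs⟩

/- Otherwise the sum of `n` orthogonal translates of `w` has norm of order `√n`, but inner product
with `ζ` of order `n`. -/
theorem inner_eq_zero_of_mem_fixed [NoncompactSpace G] (ρ : UnitaryRep G) {w : ρ.H} {K : Set G}
    (hK : IsCompact K) (hw : ∀ s ∉ K, inner ℂ w (ρ.π s w) = 0) {ζ : ρ.H} (hζ : ζ ∈ ρ.fixed ⊤) :
    inner ℂ w ζ = 0 := by
  by_contra hne
  have hpos : 0 < ‖inner ℂ w ζ‖ ^ 2 := by positivity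
  obtain ⟨n, hn⟩ := exists_nat_gt (‖w‖ ^ 2 * ‖ζ‖ ^ 2 / ‖inner ℂ w ζ‖ ^ 2)
  have hn₀ : (0 : ℝ) < n := lt_of_le_of_lt (by positivity) hn
  rw [div_lt_iff₀ hpos] at hn
  obtain ⟨S, hS, horth⟩ := ρ.exists_orthogonal_translates hK hw n
  have hinner : inner ℂ (∑ s ∈ S, ρ.π s w) ζ = n * inner ℂ w ζ := by
    simp only [sum_inner, inner_π_left, hζ _ (Subgroup.mem_top _), Finset.sum_const, hS,
      nsmul_eq_mul]
  have hnorm : ‖∑ s ∈ S, ρ.π s w‖ ^ 2 = n * ‖w‖ ^ 2 := by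
    rw [norm_sum_sq_eq_sum_norm_sq horth]
    simp only [LinearIsometryEquiv.norm_map, Finset.sum_const, hS, nsmul_eq_mul]
  have hle : n * (n * ‖inner ℂ w ζ‖ ^ 2) ≤ n * (‖w‖ ^ 2 * ‖ζ‖ ^ 2) :=
    calc n * (n * ‖inner ℂ w ζ‖ ^ 2) = ‖inner ℂ (∑ s ∈ S, ρ.π s w) ζ‖ ^ 2 := by
          rw [hinner, norm_mul, Complex.norm_natCast]
          ring
      _ ≤ (‖∑ s ∈ S, ρ.π s w‖ * ‖ζ‖) ^ 2 := by
          gcongr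
          exact norm_inner_le_norm _ _
      _ = n * (‖w‖ ^ 2 * ‖ζ‖ ^ 2) := by rw [mul_pow, hnorm, mul_assoc]
  exact hn.not_ge (le_of_mul_le_mul_left hle hn₀)

/-- The representation of `G` on `ℓ²(G/N)` for an open subgroup `N` of finite index. -/
def quasiRegular (N : Subgroup G) [Fintype (G ⧸ N)] (hN : IsOpen (N : Set G)) : UnitaryRep G :=
  ofIsometry (EuclideanSpace ℂ (G ⧸ N))
    (fun s => (LinearIsometryEquiv.piLpCongrLeft 2 ℂ ℂ
      (MulAction.toPerm s : Equiv.Perm (G ⧸ N))).toContinuousLinearEquiv.toContinuousLinearMap)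
    (fun s ξ => LinearIsometryEquiv.norm_map _ ξ)
    (fun ξ => by
      ext x
      simp [LinearIsometryEquiv.piLpCongrLeft_apply, Equiv.piCongrLeft'])
    (fun s t ξ => by
      ext x
      simp [LinearIsometryEquiv.piLpCongrLeft_apply, Equiv.piCongrLeft', mul_smul])
    (fun ξ => by
      refine (PiLp.continuous_toLp 2 _).comp (continuous_pi fun x => ?_)
      induction x using QuotientGroup.induction_on with
      | H g =>
        have : DiscreteTopology (G ⧸ N) := QuotientGroup.discreteTopology hN
        exact (continuous_of_discreteTopology (f := fun y : G ⧸ N => ξ y)).comp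
          (QuotientGroup.continuous_mk.comp (continuous_inv.mul continuous_const)))

variable (N : Subgroup G) [Fintype (G ⧸ N)] (hN : IsOpen (N : Set G))

/-- The identification of the space of the quasi-regular representation with `ℓ²(G/N)`. -/
def quasiRegularEquiv : (quasiRegular N hN).H ≃ₗᵢ[ℂ] EuclideanSpace ℂ (G ⧸ N) :=
  LinearIsometryEquiv.refl ℂ (EuclideanSpace ℂ (G ⧸ N))

theorem quasiRegularEquiv_π (s : G) (ξ : (quasiRegular N hN).H) (x : G ⧸ N) :
    quasiRegularEquiv N hN ((quasiRegular N hN).π s ξ) x =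
      quasiRegularEquiv N hN ξ (s⁻¹ • x) := rfl

open Classical in
/-- The unit vector of the trivial coset. -/
def quasiRegularVec : (quasiRegular N hN).H :=
  (quasiRegularEquiv N hN).symm (EuclideanSpace.single ((1 : G) : G ⧸ N) (1 : ℂ))

theorem inner_quasiRegularVec (v : (quasiRegular N hN).H) :
    inner ℂ (quasiRegularVec N hN) v = quasiRegularEquiv N hN v ((1 : G) : G ⧸ N) := by
  classical
  rw [← (quasiRegularEquiv N hN).inner_map_map, quasiRegularVec,
    LinearIsometryEquiv.apply_symm_apply, EuclideanSpace.inner_single_left, map_one, one_mul]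

open Classical in
theorem coeff_quasiRegularVec (s : G) :
    (quasiRegular N hN).coeff (quasiRegularVec N hN) (quasiRegularVec N hN) s =
      if s ∈ N then 1 else 0 := by
  rw [coeff, inner_quasiRegularVec, quasiRegularEquiv_π, quasiRegularVec,
    LinearIsometryEquiv.apply_symm_apply, PiLp.single_apply, MulAction.Quotient.smul_coe]
  simp [QuotientGroup.eq]

/-- The constant function `1` on `G/N`. -/
def quasiRegularOne : (quasiRegular N hN).H :=
  (quasiRegularEquiv N hN).symm (WithLp.toLp 2 fun _ => 1)

theorem quasiRegularEquiv_quasiRegularOne (x : G ⧸ N) :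
    quasiRegularEquiv N hN (quasiRegularOne N hN) x = 1 := by
  simp [quasiRegularOne]

theorem quasiRegularOne_mem_fixed :
    quasiRegularOne N hN ∈ (quasiRegular N hN).fixed ⊤ := fun s _ => by
  refine (quasiRegularEquiv N hN).injective (PiLp.ext fun x => ?_)
  simp only [quasiRegularEquiv_π, quasiRegularEquiv_quasiRegularOne]

theorem inner_quasiRegularOne_of_mem_fixed {v : (quasiRegular N hN).H}
    (hv : v ∈ (quasiRegular N hN).fixed ⊤) :
    inner ℂ (quasiRegularOne N hN) v =
      (Fintype.card (G ⧸ N) : ℂ) * inner ℂ (quasiRegularVec N hN) v := by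
  have hconst (x : G ⧸ N) : quasiRegularEquiv N hN v x = inner ℂ (quasiRegularVec N hN) v := by
    induction x using QuotientGroup.induction_on with
    | H g =>
      rw [inner_quasiRegularVec, ← hv g (Subgroup.mem_top g), quasiRegularEquiv_π,
        hv g (Subgroup.mem_top g), MulAction.Quotient.smul_coe, smul_eq_mul, inv_mul_cancel]
  rw [← (quasiRegularEquiv N hN).inner_map_map, PiLp.inner_apply]
  simp only [quasiRegularEquiv_quasiRegularOne, hconst]
  simp

end

section

variable (G : Type u) [Group G] [TopologicalSpace G] [IsTopologicalGroup G]
  [LocallyCompactSpace G] [MeasurableSpace G] [BorelSpace G]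

/-- The left regular representation. -/
def regular : UnitaryRep G :=
  ofIsometry (Lp ℂ 2 (Measure.haar : Measure G))
    (fun s => (LinearIsometry.mk
      { toFun := fun f => DomMulAct.mk s⁻¹ • f
        map_add' := fun f g => smul_add _ f g
        map_smul' := fun c f => smul_comm _ c f }
      (fun f => DomMulAct.norm_smul_Lp (DomMulAct.mk s⁻¹) f)).toContinuousLinearMap)
    (fun s f => DomMulAct.norm_smul_Lp (DomMulAct.mk s⁻¹) f)
    (fun f => by
      change DomMulAct.mk (1 : G)⁻¹ • f = f
      rw [inv_one, DomMulAct.mk_one, one_smul])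
    (fun s t f => by
      change DomMulAct.mk (s * t)⁻¹ • f = DomMulAct.mk s⁻¹ • DomMulAct.mk t⁻¹ • f
      rw [mul_inv_rev, DomMulAct.mk_mul, mul_smul])
    (fun f => by
      change Continuous fun s : G => DomMulAct.mk s⁻¹ • f
      have : Fact ((2 : ℝ≥0∞) ≠ ∞) := ⟨by simp⟩
      exact (DomMulAct.continuous_mk.comp continuous_inv).smul continuous_const)

variable {G}

/-- The indicator function of a set of finite measure in the regular representation. -/
def regularVec {A : Set G} (hA : MeasurableSet A) (hA' : (Measure.haar : Measure G) A ≠ ∞) :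
    (regular G).H :=
  (indicatorConstLp 2 hA hA' (1 : ℂ) : Lp ℂ 2 (Measure.haar : Measure G))

theorem coeff_regularVec {A B : Set G} (hA : MeasurableSet A)
    (hA' : (Measure.haar : Measure G) A ≠ ∞) (hB : MeasurableSet B)
    (hB' : (Measure.haar : Measure G) B ≠ ∞) (s : G) :
    (regular G).coeff (regularVec hA hA') (regularVec hB hB') s =
      ((Measure.haar : Measure G).real (B ∩ (s⁻¹ * ·) ⁻¹' A) : ℂ) :=
  L2.inner_indicatorConstLp_one_indicatorConstLp_one hB
    (hA.preimage (measurable_const_mul s⁻¹)) hB' (by rwa [measure_preimage_mul])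

theorem coeff_regularVec_of_preimage_subset {A B : Set G} (hA : MeasurableSet A)
    (hA' : (Measure.haar : Measure G) A ≠ ∞) (hB : MeasurableSet B)
    (hB' : (Measure.haar : Measure G) B ≠ ∞) {s : G} (hs : (s⁻¹ * ·) ⁻¹' A ⊆ B) :
    (regular G).coeff (regularVec hA hA') (regularVec hB hB') s =
      ((Measure.haar : Measure G).real A : ℂ) := by
  rw [coeff_regularVec, Set.inter_eq_right.2 hs, measureReal_def, measure_preimage_mul,
    ← measureReal_def]

open scoped Pointwise in
theorem coeff_regularVec_self_of_notMem {B : Set G} (hB : MeasurableSet B)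
    (hB' : (Measure.haar : Measure G) B ≠ ∞) {s : G} (hs : s ∉ B * B⁻¹) :
    (regular G).coeff (regularVec hB hB') (regularVec hB hB') s = 0 := by
  have hdisj : B ∩ (s⁻¹ * ·) ⁻¹' B = ∅ := Set.eq_empty_iff_forall_notMem.2 fun t ⟨ht, ht'⟩ =>
    hs ⟨t, ht, (s⁻¹ * t)⁻¹, Set.inv_mem_inv.2 ht', by simp⟩
  rw [coeff_regularVec, hdisj, measureReal_empty, Complex.ofReal_zero]

open scoped Pointwise in
theorem exists_coeff_regular_eq_one {K : Set G} (hK : IsCompact K) :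
    ∃ (ξ η : (regular G).H) (L : Set G), IsCompact L ∧ (∀ s ∈ K, (regular G).coeff ξ η s = 1) ∧
      ∀ s ∉ L, (regular G).coeff η η s = 0 := by
  obtain ⟨A, hA_nhds, hA, hA_closed⟩ := exists_mem_nhds_isCompact_isClosed (1 : G)
  have hA' : (Measure.haar : Measure G) A ≠ ∞ := hA.measure_lt_top.ne
  have hB : IsCompact (closure (K * A)) := (hK.mul hA).closure
  have hBm : MeasurableSet (closure (K * A)) := isClosed_closure.measurableSet
  have hB' : (Measure.haar : Measure G) (closure (K * A)) ≠ ∞ := hB.measure_lt_top.ne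
  have hpos : 0 < (Measure.haar : Measure G).real A :=
    ENNReal.toReal_pos (Measure.measure_pos_of_mem_nhds _ hA_nhds).ne' hA'
  refine ⟨(((Measure.haar : Measure G).real A : ℂ)⁻¹) • regularVec hA_closed.measurableSet hA',
    regularVec hBm hB', _, hB.mul hB.inv, fun s hs => ?_,
    fun s => coeff_regularVec_self_of_notMem hBm hB'⟩
  have hsub : (s⁻¹ * ·) ⁻¹' A ⊆ closure (K * A) := fun t ht =>
    subset_closure ⟨s, hs, s⁻¹ * t, ht, mul_inv_cancel_left s t⟩
  have hcoeff :=
    coeff_regularVec_of_preimage_subset hA_closed.measurableSet hA' hBm hB' hsub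
  rw [coeff] at hcoeff ⊢
  rw [map_smul, inner_smul_right, hcoeff]
  exact inv_mul_cancel₀ (by exact_mod_cast hpos.ne')

end

end UnitaryRep

/-! ### The character at infinity -/

theorem finite_quotient_ker (G : Type u) [Group G] [TopologicalSpace G]
    (hAP : Finite (AlmostPeriodicCompactification G)) :
    Finite (G ⧸ (toUnitaryProduct G).ker) := by
  have : Finite (toUnitaryProduct G).range :=
    Finite.of_injective (Subgroup.inclusion (Subgroup.le_topologicalClosure _))
      (Subgroup.inclusion_injective _)
  exact Finite.of_equiv _ (QuotientGroup.quotientKerEquivRange (toUnitaryProduct G)).symm.toEquiv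

theorem isClosed_ker (G : Type u) [Group G] [TopologicalSpace G] :
    IsClosed ((toUnitaryProduct G).ker : Set G) :=
  isClosed_singleton.preimage (f := toUnitaryProduct G)
    (continuous_pi fun p => p.2.continuous_toFun)

theorem isOpen_ker (G : Type u) [Group G] [TopologicalSpace G] [IsTopologicalGroup G]
    (hAP : Finite (AlmostPeriodicCompactification G)) :
    IsOpen ((toUnitaryProduct G).ker : Set G) := by
  have := finite_quotient_ker G hAP
  have : (toUnitaryProduct G).ker.FiniteIndex := Subgroup.finiteIndex_of_finite_quotient
  exact Subgroup.isOpen_of_isClosed_of_finiteIndex _ (isClosed_ker G)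

namespace FourierStieltjes

theorem coefficient_add_left {G : Type u} [Group G] [TopologicalSpace G] (ρ : UnitaryRep G)
    (ξ ξ' η : ρ.H) : ρ.coefficient (ξ + ξ') η = ρ.coefficient ξ η + ρ.coefficient ξ' η :=
  toFun_injective (funext fun s => by
    rw [map_add, Pi.add_apply]
    simp only [UnitaryRep.toFun_coefficient, UnitaryRep.coeff, map_add, inner_add_right])

variable {G : Type u} [Group G] [TopologicalSpace G] [IsTopologicalGroup G]

section

variable {N : Subgroup G} [Fintype (G ⧸ N)] (hN : IsOpen (N : Set G))

/-- The function `[G : N] 1_N` of `B(G)`, for an open subgroup `N` of finite index. -/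
def indexIndicator : FourierStieltjes G :=
  (Fintype.card (G ⧸ N) : ℂ) • (UnitaryRep.quasiRegular N hN).coefficient
    (UnitaryRep.quasiRegularVec N hN) (UnitaryRep.quasiRegularVec N hN)

theorem indexIndicator_mul_coefficient (ρ : UnitaryRep G) {ξ : ρ.H} (hξ : ξ ∈ ρ.fixed N)
    (η : ρ.H) :
    indexIndicator hN * ρ.coefficient ξ η = (inner ℂ η ξ : ℂ) • indexIndicator hN := by
  classical
  refine toFun_injective (funext fun s => ?_)
  simp only [indexIndicator, map_mul, map_smul, UnitaryRep.toFun_coefficient,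
    Pi.mul_apply, Pi.smul_apply, UnitaryRep.coeff_quasiRegularVec, smul_eq_mul]
  by_cases hs : s ∈ N
  · simp only [hs, if_true, UnitaryRep.coeff, hξ s hs]
    ring
  · simp only [hs, if_false, mul_zero, zero_mul]

end

variable [LocallyCompactSpace G] [MeasurableSpace G] [BorelSpace G] {q : GroupCStar G}

/- Both sides are the inner product of `Pδ` with the constant function `1`, where `P` is the
projection onto the constant functions and `δ` the indicator function of the trivial coset. -/
theorem functional_indexIndicator {N : Subgroup G} [Fintype (G ⧸ N)] (hN : IsOpen (N : Set G))
    (hq : q.IsKazhdanProjection) : functional (indexIndicator hN) q = 1 := by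
  let δ := UnitaryRep.quasiRegularVec N hN
  let e := UnitaryRep.quasiRegularOne N hN
  let P := ((UnitaryRep.quasiRegular N hN).fixed ⊤).starProjection
  calc functional (indexIndicator hN) q = (Fintype.card (G ⧸ N) : ℂ) * inner ℂ δ (P δ) := by
        rw [indexIndicator, functional_smul, functional_coefficient, hq]
    _ = inner ℂ e (P δ) :=
        (UnitaryRep.inner_quasiRegularOne_of_mem_fixed N hN
          (Submodule.starProjection_apply_mem _ δ)).symm
    _ = inner ℂ e δ := by
        rw [← Submodule.inner_starProjection_left_eq_right,
          Submodule.starProjection_eq_self_iff.2 (UnitaryRep.quasiRegularOne_mem_fixed N hN)]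
    _ = 1 := by
        rw [← inner_conj_symm, UnitaryRep.inner_quasiRegularVec,
          UnitaryRep.quasiRegularEquiv_quasiRegularOne, map_one]

theorem functional_coefficient_mul_eq_zero (hq : q.IsKazhdanProjection) (ρ : UnitaryRep G)
    {ξ : ρ.H} (hξ : ξ ∈ (ρ.fixed (toUnitaryProduct G).ker)ᗮ) (η : ρ.H) (u : FourierStieltjes G) :
    functional (ρ.coefficient ξ η * u) q = 0 := by
  obtain ⟨σ, x, y, rfl⟩ := exists_coefficient u
  rw [coefficient_mul_coefficient, functional_coefficient, hq,
    (Submodule.starProjection_apply_eq_zero_iff _).2 (ρ.tmul_mem_orthogonal_fixed σ hξ x),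
    inner_zero_right]

/- Split the vector of `u` into an `N`-invariant part, where `b` reduces `u` to a scalar, and an
orthogonal part, which does not contribute. -/
theorem functional_indexIndicator_mul_mul (hq : q.IsKazhdanProjection)
    [Fintype (G ⧸ (toUnitaryProduct G).ker)] (hN : IsOpen ((toUnitaryProduct G).ker : Set G))
    (u v : FourierStieltjes G) :
    functional (indexIndicator hN * (u * v)) q =
      functional (indexIndicator hN * u) q * functional (indexIndicator hN * v) q := by
  obtain ⟨ρ, ξ, η, rfl⟩ := exists_coefficient u
  obtain ⟨ξ₀, h₀, ξ₁, h₁, rfl⟩ :=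
    (ρ.fixed (toUnitaryProduct G).ker).exists_add_mem_mem_orthogonal ξ
  have hξ₁ (w : FourierStieltjes G) :
      functional (indexIndicator hN * (ρ.coefficient ξ₁ η * w)) q = 0 := by
    rw [mul_left_comm]
    exact functional_coefficient_mul_eq_zero hq ρ h₁ η _
  have hξ₁_one : functional (indexIndicator hN * ρ.coefficient ξ₁ η) q = 0 := by
    simpa only [mul_one] using hξ₁ 1
  rw [coefficient_add_left, add_mul, mul_add, mul_add, functional_add, functional_add, hξ₁,
    hξ₁_one, ← mul_assoc, indexIndicator_mul_coefficient hN ρ h₀, smul_mul_assoc, functional_smul,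
    functional_smul, functional_indexIndicator hN hq]
  ring

/-- Elements of `C*(G)` that represent a weak*-continuous character of `B(G)`. -/
structure IsCharacter (p : GroupCStar G) : Prop where
  functional_one : functional 1 p = 1
  mulOp_eq (u : FourierStieltjes G) : mulOp u p = functional u p • p

/-- Elements of `C*(G)` that annihilate functions in `B(G)` which are `1` on arbitrarily large
compact sets. -/
def VanishesAtInfinity (p : GroupCStar G) : Prop :=
  ∀ K : Set G, IsCompact K → ∃ u : FourierStieltjes G, (∀ s ∈ K, toFun u s = 1) ∧ functional u p = 0

theorem isCharacter_mulOp_indexIndicator (hq : q.IsKazhdanProjection)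
    [Fintype (G ⧸ (toUnitaryProduct G).ker)] (hN : IsOpen ((toUnitaryProduct G).ker : Set G)) :
    IsCharacter (mulOp (indexIndicator hN) q) where
  functional_one := by rw [functional_mulOp, mul_one, functional_indexIndicator hN hq]
  mulOp_eq u := ext_functional fun v => by
    simp only [map_smul, functional_mulOp, functional_indexIndicator_mul_mul hq hN, smul_eq_mul]

theorem vanishesAtInfinity_mulOp [NoncompactSpace G] (hq : q.IsKazhdanProjection)
    (b : FourierStieltjes G) : VanishesAtInfinity (mulOp b q) := by
  intro K hK
  obtain ⟨ρ, x, y, rfl⟩ := exists_coefficient b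
  obtain ⟨ξ, η, L, hL, hKξη, hη⟩ := UnitaryRep.exists_coeff_regular_eq_one hK
  refine ⟨(UnitaryRep.regular G).coefficient ξ η, hKξη, ?_⟩
  rw [functional_mulOp, coefficient_mul_coefficient, functional_coefficient, hq]
  refine UnitaryRep.inner_eq_zero_of_mem_fixed _ hL (fun s hs => ?_)
    (Submodule.starProjection_apply_mem _ _)
  rw [UnitaryRep.tensor_π_tmul, UnitaryRep.inner_tmul]
  exact mul_eq_zero_of_right _ (hη s hs)

theorem exists_isCharacter_vanishesAtInfinity [NoncompactSpace G] (hT : HasPropertyT G)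
    (hAP : Finite (AlmostPeriodicCompactification G)) :
    ∃ p : GroupCStar G, IsCharacter p ∧ VanishesAtInfinity p := by
  obtain ⟨q, hq⟩ := GroupCStar.exists_isKazhdanProjection hT
  have := finite_quotient_ker G hAP
  let _ := Fintype.ofFinite (G ⧸ (toUnitaryProduct G).ker)
  exact ⟨_, isCharacter_mulOp_indexIndicator hq (isOpen_ker G hAP), vanishesAtInfinity_mulOp hq _⟩

end FourierStieltjes

/-! ### The dual of the augmentation ideal as a bimodule -/

/-- The matrices over the adjoint action are, up to a relabelling of the indices, pairings of `φ`
with the matrices `[S (a i j) (x k l)]`. -/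
theorem isJointlyCompletelyBounded_of_predual {A F : Type*} [AddCommGroup A] [Module ℂ A]
    [MatrixNorms A] [NormedAddCommGroup F] [NormedSpace ℂ F] [OperatorSpace F]
    (T : A →ₗ[ℂ] StrongDual ℂ F →ₗ[ℂ] StrongDual ℂ F) (S : A → F →L[ℂ] F)
    (hTS : ∀ a φ, T a φ = φ.comp (S a)) (C : ℝ≥0)
    (hC : ∀ (n r : ℕ) (a : Matrix (Fin n) (Fin n) A) (x : Matrix (Fin r) (Fin r) F),
      MatrixNorms.matNorm x ≤ 1 → MatrixNorms.matNorm
        (Matrix.of fun p q : Fin n × Fin r => S (a p.1 q.1) (x p.2 q.2)) ≤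
          C * MatrixNorms.matNorm a) :
    IsJointlyCompletelyBounded T := by
  refine ⟨C, fun n m a φ => iSup_le fun r => iSup₂_le fun x hx => ?_⟩
  let Sx : Matrix (Fin n × Fin r) (Fin n × Fin r) F :=
    Matrix.of fun p q => S (a p.1 q.1) (x p.2 q.2)
  let e : (Fin n × Fin m) × Fin r ≃ Fin m × (Fin n × Fin r) :=
    ((Equiv.prodComm _ _).prodCongr (Equiv.refl _)).trans (Equiv.prodAssoc _ _ _)
  have relabel : (Matrix.of fun p q : (Fin n × Fin m) × Fin r =>
      (Matrix.of fun p q : Fin n × Fin m => T (a p.1 q.1) (φ p.2 q.2)) p.1 q.1 (x p.2 q.2)) =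
      (Matrix.of fun p q : Fin m × (Fin n × Fin r) => φ p.1 q.1 (Sx p.2 q.2)).submatrix e e := by
    ext p q
    simp [Sx, e, hTS]
  calc _ ≤ ‖Matrix.of fun p q : Fin m × (Fin n × Fin r) => φ p.1 q.1 (Sx p.2 q.2)‖ₑ := by
        rw [relabel, enorm_le_iff_norm_le]
        exact l2_opNorm_submatrix_le _ e.injective
    _ ≤ MatrixNorms.matNorm φ * MatrixNorms.matNorm Sx := OperatorSpace.enorm_pairing_le φ Sx
    _ ≤ MatrixNorms.matNorm φ * (C * MatrixNorms.matNorm a) := by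
        gcongr
        exact hC n r a x hx
    _ = C * MatrixNorms.matNorm a * MatrixNorms.matNorm φ := by ring

namespace FourierStieltjes

variable {G : Type u} [Group G] [TopologicalSpace G] [IsTopologicalGroup G]
  [LocallyCompactSpace G] [MeasurableSpace G] [BorelSpace G]

theorem enorm_functional_le {ι κ : Type} [Fintype ι] [DecidableEq ι] [Fintype κ] [DecidableEq κ]
    (u : Matrix ι ι (FourierStieltjes G)) (x : Matrix κ κ (GroupCStar G)) :
    ‖(Matrix.of fun i j : ι × κ => functional (u i.1 j.1) (x i.2 j.2))‖ₑ ≤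
      MatrixNorms.matNorm u * MatrixNorms.matNorm x :=
  OperatorSpace.enorm_pairing_le (u.map toDual) x

theorem matNorm_smul_const_le {ι : Type} [Fintype ι] [DecidableEq ι] (c : Matrix ι ι ℂ)
    (p : GroupCStar G) :
    MatrixNorms.matNorm (Matrix.of fun i j => c i j • p) ≤ ‖c‖ₑ * ‖p‖ₑ := by
  let x : Matrix (Fin 1) (Fin 1) (GroupCStar G) := Matrix.of fun _ _ => p
  let e := (Equiv.prodUnique ι (Fin 1)).symm
  calc _ = MatrixNorms.matNorm
          ((Matrix.of fun i j : ι × Fin 1 => c i.1 j.1 • x i.2 j.2).submatrix e e) := rfl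
    _ ≤ MatrixNorms.matNorm (Matrix.of fun i j : ι × Fin 1 => c i.1 j.1 • x i.2 j.2) :=
        OperatorSpace.matNorm_submatrix_le _ e.injective e.injective
    _ ≤ ‖c‖ₑ * ‖p‖ₑ := by
        rw [← OperatorSpace.matNorm_single p]
        exact GroupCStar.matNorm_kronecker_le c x

theorem enorm_functional_const_le {ι : Type} [Fintype ι] [DecidableEq ι]
    (u : Matrix ι ι (FourierStieltjes G)) (p : GroupCStar G) :
    ‖(Matrix.of fun i j : ι => functional (u i j) p)‖ₑ ≤ MatrixNorms.matNorm u * ‖p‖ₑ := by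
  let x : Matrix (Fin 1) (Fin 1) (GroupCStar G) := Matrix.of fun _ _ => p
  let e := (Equiv.prodUnique ι (Fin 1)).symm
  calc _ = ‖(Matrix.of fun i j : ι × Fin 1 =>
          functional (u i.1 j.1) (x i.2 j.2)).submatrix e e‖ₑ := rfl
    _ ≤ ‖(Matrix.of fun i j : ι × Fin 1 => functional (u i.1 j.1) (x i.2 j.2))‖ₑ :=
        enorm_le_iff_norm_le.2 (l2_opNorm_submatrix_le _ e.injective)
    _ ≤ MatrixNorms.matNorm u * ‖p‖ₑ := by
        rw [← OperatorSpace.matNorm_single p]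
        exact enorm_functional_le u x

theorem continuous_functional (x : GroupCStar G) :
    Continuous fun u : FourierStieltjes G => functional u x :=
  (WeakDual.eval_continuous x).comp continuous_induced_dom

variable (G) in
/-- The augmentation ideal: the kernel of the trivial representation in `C*(G)`. -/
abbrev augmentation : Submodule ℂ (GroupCStar G) :=
  LinearMap.ker (functional (1 : FourierStieltjes G)).toLinearMap

instance : CompleteSpace (augmentation G) :=
  (functional (1 : FourierStieltjes G)).isClosed_ker.completeSpace_coe

theorem matNorm_functional_smul_le (p : GroupCStar G) (n r : ℕ)
    (u : Matrix (Fin n) (Fin n) (FourierStieltjes G))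
    (x : Matrix (Fin r) (Fin r) (augmentation G)) (hx : MatrixNorms.matNorm x ≤ 1) :
    MatrixNorms.matNorm (Matrix.of fun i j : Fin n × Fin r =>
      (functional (u i.1 j.1) p • ContinuousLinearMap.id ℂ (augmentation G)) (x i.2 j.2)) ≤
      ‖p‖₊ * MatrixNorms.matNorm u := by
  let c : Matrix (Fin n) (Fin n) ℂ := Matrix.of fun i j => functional (u i j) p
  calc _ ≤ ‖c‖ₑ * MatrixNorms.matNorm (x.map (augmentation G).subtype) :=
        GroupCStar.matNorm_kronecker_le c (x.map (augmentation G).subtype)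
    _ ≤ (MatrixNorms.matNorm u * ‖p‖ₑ) * 1 := mul_le_mul' (enorm_functional_const_le u p) hx
    _ = _ := by rw [mul_one, mul_comm, enorm_eq_nnnorm]

/-- The restriction of the functionals in `B(G)` to the augmentation ideal. -/
def restriction : FourierStieltjes G →ₗ[ℂ] StrongDual ℂ (augmentation G) where
  toFun u := (functional u).comp (augmentation G).subtypeL
  map_add' u v := by ext x; exact functional_add u v x
  map_smul' c u := by ext x; exact functional_smul c u x

theorem isCompletelyBounded_restriction : IsCompletelyBounded (restriction (G := G)) := by
  refine ⟨1, fun n u => iSup_le fun r => iSup₂_le fun x hx => ?_⟩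
  calc _ ≤ MatrixNorms.matNorm u * MatrixNorms.matNorm (x.map (augmentation G).subtype) :=
        enorm_functional_le u (x.map (augmentation G).subtype)
    _ ≤ MatrixNorms.matNorm u := mul_le_of_le_one_right' hx
    _ = _ := by rw [ENNReal.coe_one, one_mul]

theorem continuous_restriction :
    Continuous fun u : FourierStieltjes G => StrongDual.toWeakDual (restriction u) :=
  WeakDual.continuous_of_continuous_eval fun x => continuous_functional (x : GroupCStar G)

namespace IsCharacter

variable {p : GroupCStar G} (hp : IsCharacter p)
include hp

theorem functional_mul (u v : FourierStieltjes G) :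
    functional (u * v) p = functional u p * functional v p := by
  rw [← functional_mulOp, hp.mulOp_eq, map_smul, smul_eq_mul]

/-- The projection of `C*(G)` onto the augmentation ideal along `p`. -/
def proj : GroupCStar G →L[ℂ] augmentation G :=
  (ContinuousLinearMap.id ℂ (GroupCStar G) -
    (functional (1 : FourierStieltjes G)).smulRight p).codRestrict _ fun x => by
      change functional 1 (x - functional 1 x • p) = 0
      rw [map_sub, map_smul, hp.functional_one, smul_eq_mul, mul_one, sub_self]

theorem coe_proj (x : GroupCStar G) : (hp.proj x : GroupCStar G) = x - functional 1 x • p := rfl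

theorem proj_self : hp.proj p = 0 :=
  Subtype.ext (by rw [coe_proj, hp.functional_one, one_smul, sub_self, ZeroMemClass.coe_zero])

/-- The action of `B(G)` on the augmentation ideal, viewed as the quotient of `C*(G)` by the line
through `p`. -/
def act (u : FourierStieltjes G) : augmentation G →L[ℂ] augmentation G :=
  hp.proj.comp ((mulOp u).comp (augmentation G).subtypeL)

theorem act_apply (u : FourierStieltjes G) (x : augmentation G) :
    hp.act u x = hp.proj (mulOp u x) := rfl

theorem coe_act (u : FourierStieltjes G) (x : augmentation G) :
    (hp.act u x : GroupCStar G) = mulOp u x - functional u x • p := by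
  rw [act_apply, coe_proj, functional_mulOp, mul_one]

theorem act_add (u v : FourierStieltjes G) : hp.act (u + v) = hp.act u + hp.act v := by
  ext x
  simp only [add_apply, act_apply, mulOp_add, map_add]

theorem act_smul (c : ℂ) (u : FourierStieltjes G) : hp.act (c • u) = c • hp.act u := by
  ext x
  simp only [smul_apply, act_apply, mulOp_smul, map_smul]

theorem act_proj (u : FourierStieltjes G) (y : GroupCStar G) :
    hp.act u (hp.proj y) = hp.proj (mulOp u y) := by
  rw [act_apply, coe_proj, map_sub, map_sub, map_smul, map_smul, hp.mulOp_eq, map_smul,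
    proj_self, smul_zero, smul_zero, sub_zero]

theorem act_mul (u v : FourierStieltjes G) (x : augmentation G) :
    hp.act (u * v) x = hp.act v (hp.act u x) := by
  rw [act_apply hp u, act_proj, act_apply, mulOp_mul]

theorem matNorm_act_le (n r : ℕ) (u : Matrix (Fin n) (Fin n) (FourierStieltjes G))
    (x : Matrix (Fin r) (Fin r) (augmentation G)) (hx : MatrixNorms.matNorm x ≤ 1) :
    MatrixNorms.matNorm (Matrix.of fun i j : Fin n × Fin r => hp.act (u i.1 j.1) (x i.2 j.2)) ≤
      (1 + ‖p‖₊ : ℝ≥0) * MatrixNorms.matNorm u := by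
  let y := x.map (augmentation G).subtype
  have hy : MatrixNorms.matNorm u * MatrixNorms.matNorm y ≤ MatrixNorms.matNorm u :=
    mul_le_of_le_one_right' hx
  let c : Matrix (Fin n × Fin r) (Fin n × Fin r) ℂ :=
    Matrix.of fun i j => functional (u i.1 j.1) (y i.2 j.2)
  have hc : ‖c‖ₑ ≤ MatrixNorms.matNorm u := (enorm_functional_le u y).trans hy
  have act_eq : (Matrix.of fun i j : Fin n × Fin r => hp.act (u i.1 j.1) (x i.2 j.2)).map
      (augmentation G).subtype =
      (Matrix.of fun i j : Fin n × Fin r => mulOp (u i.1 j.1) (y i.2 j.2)) +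
        Matrix.of fun i j => c i j • (-p) := by
    ext i j
    simp only [Matrix.map_apply, Matrix.of_apply, Matrix.add_apply, Submodule.subtype_apply,
      coe_act, smul_neg, sub_eq_add_neg, c, y]
  calc _ = MatrixNorms.matNorm ((Matrix.of fun i j : Fin n × Fin r =>
          hp.act (u i.1 j.1) (x i.2 j.2)).map (augmentation G).subtype) := rfl
    _ ≤ MatrixNorms.matNorm (Matrix.of fun i j : Fin n × Fin r =>
          mulOp (u i.1 j.1) (y i.2 j.2)) +
        MatrixNorms.matNorm (Matrix.of fun i j => c i j • (-p)) := by
        rw [act_eq]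
        exact OperatorSpace.matNorm_add_le _ _
    _ ≤ MatrixNorms.matNorm u + MatrixNorms.matNorm u * ‖p‖ₑ := by
        refine add_le_add ((matNorm_mulOp_le u y).trans hy)
          ((matNorm_smul_const_le c (-p)).trans ?_)
        rw [enorm_neg]
        gcongr
    _ = _ := by
        rw [ENNReal.coe_add, ENNReal.coe_one, add_mul, one_mul, mul_comm _ ‖p‖ₑ,
          enorm_eq_nnnorm]

/-- The dual of the augmentation ideal with the transpose of `act` as left action, and with the
right action given by the character represented by `p`. -/
def bimodule : NormalDualOperatorBimodule (FourierStieltjes G) (augmentation G) where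
  left := LinearMap.mk₂ ℂ (fun u φ => φ.comp (hp.act u))
    (fun u v φ => by rw [act_add, ContinuousLinearMap.comp_add])
    (fun c u φ => by rw [act_smul, ContinuousLinearMap.comp_smul])
    (fun u φ ψ => ContinuousLinearMap.add_comp _ _ _)
    (fun c u φ => ContinuousLinearMap.smul_comp _ _ _)
  right := LinearMap.mk₂ ℂ (fun u φ => functional u p • φ)
    (fun u v φ => (congrArg (· • φ) (functional_add u v p)).trans (add_smul _ _ φ))
    (fun c u φ => (congrArg (· • φ) (functional_smul c u p)).trans (mul_smul _ _ φ))
    (fun u φ ψ => smul_add _ _ _)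
    (fun c u φ => smul_comm _ _ _)
  left_mul u v φ := by
    ext x
    exact congrArg φ (hp.act_mul u v x)
  right_mul u v φ := by
    change functional (u * v) p • φ = functional v p • functional u p • φ
    rw [hp.functional_mul, smul_smul, mul_comm]
  left_right u v φ := ContinuousLinearMap.smul_comp _ _ _
  left_cb := isJointlyCompletelyBounded_of_predual _ hp.act (fun _ _ => rfl) (1 + ‖p‖₊)
    hp.matNorm_act_le
  right_cb := isJointlyCompletelyBounded_of_predual _
    (fun u => functional u p • ContinuousLinearMap.id ℂ (augmentation G))
    (fun u φ => by rw [ContinuousLinearMap.comp_smul, ContinuousLinearMap.comp_id]; rfl) ‖p‖₊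
    (matNorm_functional_smul_le p)
  left_dual u := WeakDual.continuous_of_continuous_eval fun x =>
    WeakDual.eval_continuous (hp.act u x)
  right_dual u := WeakDual.continuous_of_continuous_eval fun x =>
    continuous_const.mul (WeakDual.eval_continuous x)
  left_normal φ := WeakDual.continuous_of_continuous_eval fun x => by
    obtain ⟨y, hy⟩ := exists_functional_eq (φ.comp hp.proj) (x : GroupCStar G)
    exact (continuous_functional y).congr fun u => (hy u).symm
  right_normal φ := WeakDual.continuous_of_continuous_eval fun x =>
    (continuous_functional p).mul continuous_const

theorem restriction_mul (u v : FourierStieltjes G) :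
    restriction (u * v) =
      hp.bimodule.left u (restriction v) + hp.bimodule.right v (restriction u) := by
  ext x
  change functional (u * v) (x : GroupCStar G) =
    functional v (hp.act u x : GroupCStar G) + functional v p * functional u (x : GroupCStar G)
  rw [coe_act, map_sub, map_smul, functional_mulOp, smul_eq_mul]
  ring

theorem apply_proj_mulOp {φ : StrongDual ℂ (augmentation G)}
    (hφ : ∀ u, restriction u = hp.bimodule.left u φ - hp.bimodule.right u φ)
    {u : FourierStieltjes G} (hu : functional u p = 0) (y : GroupCStar G) :
    φ (hp.proj (mulOp u y)) = functional u y := by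
  have h : functional u (hp.proj y : GroupCStar G) =
      φ (hp.act u (hp.proj y)) - functional u p * φ (hp.proj y) :=
    DFunLike.congr_fun (hφ u) (hp.proj y)
  rw [hu, zero_mul, sub_zero, act_proj, coe_proj, map_sub, map_smul, hu, smul_zero, sub_zero] at h
  exact h.symm

/- The functions in `B(G)` that are annihilated by `p` act as local units on `C_c(G)`. -/
theorem apply_proj_eq_functional_one (hp_inf : VanishesAtInfinity p)
    {φ : StrongDual ℂ (augmentation G)}
    (hφ : ∀ u, restriction u = hp.bimodule.left u φ - hp.bimodule.right u φ)
    (y : GroupCStar G) : φ (hp.proj y) = functional 1 y := by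
  induction y using UniformSpace.Completion.induction_on with
  | hp => exact isClosed_eq (by fun_prop) (by fun_prop)
  | ih f =>
    obtain ⟨u, hu_one, hu⟩ := hp_inf _ (PreGroupCStar.toCc G f).hasCompactSupport.isCompact
    have mulOp_eq_self : mulOp u (f : GroupCStar G) = f := by
      rw [mulOp_coe, mulPre_eq_self hu_one]
    calc φ (hp.proj f) = functional u (f : GroupCStar G) := by
          rw [← hp.apply_proj_mulOp hφ hu, mulOp_eq_self]
      _ = functional 1 (f : GroupCStar G) := by
          rw [← mul_one u, ← functional_mulOp, mulOp_eq_self]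

theorem not_isOperatorConnesAmenable (hp_inf : VanishesAtInfinity p) :
    ¬ IsOperatorConnesAmenable (FourierStieltjes G) := by
  intro hCA
  obtain ⟨φ, hφ⟩ := hCA (augmentation G) hp.bimodule restriction isCompletelyBounded_restriction
    continuous_restriction hp.restriction_mul
  refine one_ne_zero (α := ℂ) ?_
  calc (1 : ℂ) = φ (hp.proj p) := by
        rw [hp.apply_proj_eq_functional_one hp_inf hφ, hp.functional_one]
    _ = 0 := by rw [hp.proj_self, map_zero]

end IsCharacter

end FourierStieltjes

end

theorem theorem3p2_general {G : Type*} [Group G] [TopologicalSpace G] [IsTopologicalGroup G]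
    [LocallyCompactSpace G] [NoncompactSpace G] [MeasurableSpace G] [BorelSpace G]
    (hT : HasPropertyT G) (hAP : Finite (AlmostPeriodicCompactification G)) :
    ¬ IsOperatorConnesAmenable (FourierStieltjes G) := by
  obtain ⟨p, hp, hp_inf⟩ := FourierStieltjes.exists_isCharacter_vanishesAtInfinity hT hAP
  exact hp.not_isOperatorConnesAmenable hp_inf

theorem theorem3p2 {G : Type*} [Group G] [TopologicalSpace G] [IsTopologicalGroup G]
    [LocallyCompactSpace G] [T2Space G] [NoncompactSpace G] [MeasurableSpace G] [BorelSpace G]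
    (hT : HasPropertyT G) (hAP : Finite (AlmostPeriodicCompactification G)) :
    ¬ IsOperatorConnesAmenable (FourierStieltjes G) := by
  exact theorem3p2_general hT hAP
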